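/- A Euclidean TSP instance is a finite set $P$ of at least three points in the Euclidean plane; the cost of an edge is the Euclidean distance of its endpoints. A tour visits every point of $P$ exactly once and returns to its start; its length is the sum of the distances between consecutive points. The subtour LP of $P$, on the complete graph $K$ with vertex set $P$ and edge costs $c_e$, is $$\min \sum_{e\in E(K)} c_e x_e \quad\text{s.t.}\quad 0\le x_e\le 1\ (e\in E(K)),\qquad \sum_{e\in\delta(v)}x_e=2\ (v\in P),\qquad \sum_{e\in E(K[X])}x_e\le |X|-1\ (\emptyset\neq X\subsetneq P).$$ The integrality ratio of $P$ is the length of an optimum tour divided by the optimum value of the subtour LP; the integrality ratio of the Euclidean TSP is the supremum of the integrality ratios of all Euclidean TSP instances. For integers $n,m\ge 1$ the tetrahedron instance $T_{n,m}$ is the set of the $3(n+m)-2$ points $$a_i=\left(n-\tfrac i2,\ \tfrac{i\sqrt3}{2}\right),\quad b_i=\left(\tfrac n2-\tfrac i2,\ \tfrac{(n-i)\sqrt3}{2}\right),\quad c_i=(i,0)\qquad (0\le i\le n),$$ $$e_j=\left(\tfrac{jn}{2m},\ \tfrac{jn}{2\sqrt3\,m}\right),\quad f_j=\left(n-\tfrac{jn}{2m},\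 \tfrac{jn}{2\sqrt3\,m}\right),\quad g_j=\left(\tfrac n2,\ \tfrac{n\sqrt3}{2}-\tfrac{jn}{\sqrt3\,m}\right)\qquad (0\le j\le m),$$ that is, an equilateral triangle of side length $n$ whose sides are subdivided into $n$ equal parts and whose three segments from a corner to the center are subdivided into $m$ equal parts. Theorem. For $n\le\frac32 m$ the integrality ratio of $T_{n,m}$ converges to $4/3$ as $n\to\infty$, uniformly in $m$: for every $\varepsilon>0$ there is an $N$ such that for all integers $n\ge N$ with $n \ge 1$ and all integers $m\ge1$ with $n\le\frac32 m$, the integrality ratio of $T_{n,m}$ differs from $4/3$ by less than $\varepsilon$. In particular, the integrality ratio of the Euclidean TSP is at least $4/3$. -/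

import Mathlib

namespace TSP

noncomputable section

/-- The edge set of the complete graph on the vertex set `V`. -/
def edges (V : Type*) [Fintype V] : Finset (Sym2 V) :=
  open Classical in Finset.univ.filter (fun e => ¬ e.IsDiag)

/-- `delta v` is the set of edges of the complete graph that are incident to `v`. -/
def delta {V : Type*} [Fintype V] (v : V) : Finset (Sym2 V) :=
  open Classical in (edges V).filter (fun e => v ∈ e)

/-- The edges of the complete graph that have both endpoints in `X`. -/
def inducedEdges {V : Type*} [Fintype V] (X : Finset V) : Finset (Sym2 V) :=
  open Classical in (edges V).filter (fun e => ∀ v ∈ e, v ∈ X)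

/-- Feasibility for the subtour LP on the complete graph with vertex set `V`.
The values of `x` on the diagonal of `Sym2 V` play no role. -/
structure IsSubtourFeasible {V : Type*} [Fintype V] (x : Sym2 V → ℝ) : Prop where
  nonneg : ∀ e ∈ edges V, 0 ≤ x e
  le_one : ∀ e ∈ edges V, x e ≤ 1
  degree : ∀ v : V, ∑ e ∈ delta v, x e = 2
  subtour : ∀ X : Finset V, X.Nonempty → X ≠ Finset.univ →
    ∑ e ∈ inducedEdges X, x e ≤ (X.card : ℝ) - 1

/-- The cost of an edge in a metric space: the distance of its endpoints. -/
def edgeCost {V : Type*} [PseudoMetricSpace V] : Sym2 V → ℝ :=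
  Sym2.lift ⟨fun u v => dist u v, fun u v => dist_comm u v⟩

/-- The optimum value of the subtour LP (the objective is bounded below by `0`). -/
def subtourLPValue (V : Type*) [Fintype V] [PseudoMetricSpace V] : ℝ :=
  sInf {L : ℝ | ∃ x : Sym2 V → ℝ, IsSubtourFeasible x ∧ L = ∑ e ∈ edges V, edgeCost e * x e}

/-- The length of the tour that visits every vertex exactly once, in the cyclic order `f`. -/
def tourLength {V : Type*} [Fintype V] [PseudoMetricSpace V]
    (f : Fin (Fintype.card V) ≃ V) : ℝ :=
  ∑ i, dist (f i) (f (finRotate (Fintype.card V) i))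

/-- The length of an optimum tour (there are finitely many tours, and at least one). -/
def optTourLength (V : Type*) [Fintype V] [PseudoMetricSpace V] : ℝ :=
  sInf {L : ℝ | ∃ f : Fin (Fintype.card V) ≃ V, L = tourLength f}

/-- The Euclidean plane. -/
abbrev Plane : Type := EuclideanSpace ℝ (Fin 2)

/-- The integrality ratio of the Euclidean TSP instance given by a finite set of points. -/
def integralityRatio (P : Finset Plane) : ℝ := optTourLength P / subtourLPValue P

/-- The integrality ratio of the Euclidean TSP: the supremum of the integrality ratios of all
instances. A tour needs at least three vertices. -/
def euclideanIntegralityRatio : EReal :=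
  ⨆ (P : Finset Plane) (_ : 3 ≤ P.card), ((integralityRatio P : ℝ) : EReal)

section Tetrahedron

variable (n m : ℕ)

/-- The vertices on the base side from `B = (n, 0)` to `C = (n / 2, n * √3 / 2)`. -/
def ptA (i : ℕ) : Plane := !₂[(n : ℝ) - i / 2, i * √3 / 2]

/-- The vertices on the base side from `C` to `A = (0, 0)`. -/
def ptB (i : ℕ) : Plane := !₂[(n : ℝ) / 2 - i / 2, ((n : ℝ) - i) * √3 / 2]

/-- The vertices on the base side from `A` to `B`. -/
def ptC (i : ℕ) : Plane := !₂[(i : ℝ), 0]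

/-- The vertices on the internal segment from `A` to the center `M`. -/
def ptE (j : ℕ) : Plane := !₂[(j : ℝ) * n / (2 * m), j * n / (2 * √3 * m)]

/-- The vertices on the internal segment from `B` to `M`. -/
def ptF (j : ℕ) : Plane := !₂[(n : ℝ) - j * n / (2 * m), j * n / (2 * √3 * m)]

/-- The vertices on the internal segment from `C` to `M`. -/
def ptG (j : ℕ) : Plane := !₂[(n : ℝ) / 2, n * √3 / 2 - j * n / (√3 * m)]

/-- The tetrahedron instance `T_{n,m}` (for `n, m ≥ 1`). -/
def tetrahedron : Finset Plane :=
  open Classical in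
  (Finset.range (n + 1)).image (ptA n) ∪ (Finset.range (n + 1)).image (ptB n) ∪
  (Finset.range (n + 1)).image ptC ∪
  (Finset.range (m + 1)).image (ptE n m) ∪ (Finset.range (m + 1)).image (ptF n m) ∪
  (Finset.range (m + 1)).image (ptG n m)

end Tetrahedron

end

end TSP

/-! The six subdivided segments form a complete graph on four corners: the three corners of the
triangle and its center. Balls around the corners with suitable radii `r a` touch pairwise, so a
segment has length `r a + r b`. With `x = ∑ a, r a`, all segments together have length `3 * x`. The
LP value is `3 * x` up to a constant and the optimum tour has length `4 * x - o(x)`, whence the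
ratio `4 / 3`.

LP: the complete graph on four corners has three Hamiltonian cycles, and each segment lies on two of
them. Half their sum costs `3 * x`, and it is feasible once one cycle skips the corners
(`exists_feasible_le`). Conversely, moats of half the nearest-neighbor distance lose only a bounded
amount near the corners (`Network.le_subtourLPValue`).

Tour: traversing all segments, two disjoint ones twice, gives a closed walk of length `4 * x`
(`optTourLength_le_four_mul`). For the lower bound, consider the circles around a corner inside its
ball. Such a circle cuts three arms. If on each arm a tour edge within that arm crosses it, there
are at least three crossings, hence four by parity (`four_le_crossings`). Integrating over the
radii, and using that the balls do not overlap, gives `4 * x` up to the total length of the gaps,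
i.e. the parts of arms not spanned by such an edge (`four_mul_sum_r_le`). Between two gaps the tour
must leave the segment, and away from the corners this needs an edge of length at least `R / 4`. So
there are few gaps (`h_mul_card_gaps_le`), and the loss is of order `R + x / R`.

All error terms depend only on `x` and `R`, because no part is longer than 1. This is what `n ≤ 3 /
2 * m` provides, and it makes the convergence uniform in `m`. -/

namespace TSP

open Finset

/-! ### Edge multiplicities of cyclic permutations -/

section SumOverEdges

variable {V : Type*} [Fintype V]

open Classical in
/-- How often the cyclic orbits of `σ` traverse the edge `e`. -/
noncomputable def cycleMult (σ : Equiv.Perm V) (e : Sym2 V) : ℝ :=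
  ∑ u ∈ σ.support, if s(u, σ u) = e then 1 else 0

open Classical in
lemma sum_mul_cycleMult (σ : Equiv.Perm V) (E : Finset (Sym2 V)) (g : Sym2 V → ℝ) :
    ∑ e ∈ E, g e * cycleMult σ e =
      ∑ u ∈ σ.support, if s(u, σ u) ∈ E then g s(u, σ u) else 0 := by
  simp only [cycleMult, Finset.mul_sum]
  rw [Finset.sum_comm]
  refine Finset.sum_congr rfl fun u _ => ?_
  simp

open Classical in
lemma sum_cycleMult (σ : Equiv.Perm V) (E : Finset (Sym2 V)) :
    ∑ e ∈ E, cycleMult σ e = ((σ.support.filter fun u => s(u, σ u) ∈ E).card : ℝ) := by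
  have := sum_mul_cycleMult σ E (fun _ => 1)
  simp only [one_mul] at this
  rw [this]
  simp

lemma cycleMult_nonneg (σ : Equiv.Perm V) (e : Sym2 V) : 0 ≤ cycleMult σ e := by
  classical
  exact Finset.sum_nonneg fun u _ => by split_ifs <;> norm_num

open Classical in
lemma mk_mem_edges {u v : V} : s(u, v) ∈ edges V ↔ u ≠ v := by
  simp [edges]

open Classical in
lemma mk_mem_delta {u v w : V} : s(u, v) ∈ delta w ↔ u ≠ v ∧ (w = u ∨ w = v) := by
  simp [delta, mk_mem_edges]

open Classical in
lemma mk_mem_inducedEdges {u v : V} {X : Finset V} :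
    s(u, v) ∈ inducedEdges X ↔ u ≠ v ∧ u ∈ X ∧ v ∈ X := by
  simp [inducedEdges, mk_mem_edges]

open Classical in
-- Edges are counted by their tails, and exactly the tails `v` and `σ⁻¹ v` give an edge at `v`. This
-- includes a transposition, which traverses its edge twice.
lemma sum_delta_cycleMult (σ : Equiv.Perm V) (v : V) :
    ∑ e ∈ delta v, cycleMult σ e = if v ∈ σ.support then 2 else 0 := by
  rw [sum_cycleMult]
  split_ifs with hv
  · have : (σ.support.filter fun u => s(u, σ u) ∈ delta v) = {v, σ⁻¹ v} := by
      ext u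
      simp only [mem_filter, mk_mem_delta, mem_insert, mem_singleton, Equiv.Perm.mem_support]
      constructor
      · rintro ⟨h1, h2, rfl | rfl⟩ <;> simp
      · rintro (rfl | rfl)
        · exact ⟨Equiv.Perm.mem_support.1 hv, (Equiv.Perm.mem_support.1 hv).symm, Or.inl rfl⟩
        · have h : σ (σ⁻¹ v) ≠ σ⁻¹ v := by
            intro h
            apply Equiv.Perm.mem_support.1 hv
            have h' := congrArg σ h
            simpa using h'
          exact ⟨h, h.symm, Or.inr (by simp)⟩
    rw [this, Finset.card_pair]
    · norm_num
    · intro h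
      apply Equiv.Perm.mem_support.1 hv
      conv_lhs => rw [h]
      simp
  · have : (σ.support.filter fun u => s(u, σ u) ∈ delta v) = ∅ := by
      ext u
      simp only [mem_filter, mk_mem_delta, notMem_empty, iff_false, not_and]
      rintro h1 h2 (rfl | rfl)
      · exact hv h1
      · exact hv (Equiv.Perm.apply_mem_support.2 h1)
    simp [this]

/-- `σ` is split by `X` when its support meets both `X` and the complement of `X`. -/
def IsSplit [DecidableEq V] (σ : Equiv.Perm V) (X : Finset V) : Prop :=
  (∃ u ∈ σ.support, u ∈ X) ∧ ∃ u ∈ σ.support, u ∉ X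

lemma exists_leaving [DecidableEq V] {σ : Equiv.Perm V} (hσ : σ.IsCycle) {X : Finset V}
    (h : IsSplit σ X) : ∃ u ∈ σ.support, u ∈ X ∧ σ u ∉ X := by
  obtain ⟨⟨u, hu, huX⟩, w, hw, hwX⟩ := h
  by_contra! hc
  obtain ⟨k, hk⟩ := hσ.exists_pow_eq (Equiv.Perm.mem_support.1 hu) (Equiv.Perm.mem_support.1 hw)
  have : ∀ k : ℕ, (σ ^ k) u ∈ σ.support ∧ (σ ^ k) u ∈ X := by
    intro k
    induction k with
    | zero => exact ⟨hu, huX⟩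
    | succ k ih =>
      rw [pow_succ', Equiv.Perm.mul_apply]
      exact ⟨Equiv.Perm.apply_mem_support.2 ih.1, hc _ ih.1 ih.2⟩
  exact hwX (hk ▸ (this k).2)

open Classical in
-- Every edge inside `X` has its tail in `X`. A cycle split by `X` also has a tail in `X` whose edge
-- leaves `X`, which saves one.
lemma sum_induced_cycleMult_le {σ : Equiv.Perm V} (hσ : σ.IsCycle) (X : Finset V) :
    ∑ e ∈ inducedEdges X, cycleMult σ e ≤
      ((σ.support.filter (· ∈ X)).card : ℝ) - if IsSplit σ X then 1 else 0 := by
  rw [sum_cycleMult]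
  have hsub : (σ.support.filter fun u => s(u, σ u) ∈ inducedEdges X) ⊆
      σ.support.filter (· ∈ X) := by
    intro u hu
    simp only [mem_filter, mk_mem_inducedEdges] at hu ⊢
    exact ⟨hu.1, hu.2.2.1⟩
  split_ifs with h
  · obtain ⟨u, hu, huX, hσX⟩ := exists_leaving hσ h
    have hss : (σ.support.filter fun u => s(u, σ u) ∈ inducedEdges X) ⊂
        σ.support.filter (· ∈ X) := by
      refine (Finset.ssubset_iff_of_subset hsub).2 ⟨u, by simp_all, ?_⟩
      simp [mk_mem_inducedEdges, hσX]
    have := Finset.card_lt_card hss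
    have : ((σ.support.filter fun u => s(u, σ u) ∈ inducedEdges X).card : ℝ) + 1 ≤
      (σ.support.filter (· ∈ X)).card := by exact_mod_cast this
    linarith
  · rw [sub_zero]
    exact_mod_cast Finset.card_le_card hsub

lemma sum_cost_cycleMult {V : Type*} [Fintype V] [MetricSpace V] (σ : Equiv.Perm V) :
    ∑ e ∈ edges V, edgeCost e * cycleMult σ e = ∑ u, dist u (σ u) := by
  classical
  rw [sum_mul_cycleMult]
  rw [← Finset.sum_subset (Finset.subset_univ σ.support)]
  · refine Finset.sum_congr rfl fun u hu => ?_
    rw [if_pos (mk_mem_edges.2 (Equiv.Perm.mem_support.1 hu).symm)]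
    rfl
  · intro u _ hu
    rw [Equiv.Perm.notMem_support.1 hu, dist_self]

end SumOverEdges

/-! ### Half sums of three cycles in the subtour polytope -/

section ThreeCycles

variable {V : Type*} [Fintype V]

open Classical in
/-- Half the sum of three cycles such that every vertex lies on exactly two of them and any two
of them meet is feasible for the subtour LP. -/
lemma isSubtourFeasible_three_cycles (hV : 3 ≤ Fintype.card V) (σ : Fin 3 → Equiv.Perm V)
    (hσ : ∀ k, (σ k).IsCycle)
    (htwo : ∀ v, (Finset.univ.filter fun k => v ∈ (σ k).support).card = 2)
    (hmeet : ∀ k l, ∃ v, v ∈ (σ k).support ∧ v ∈ (σ l).support) :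
    IsSubtourFeasible fun e => (∑ k, cycleMult (σ k) e) / 2 := by
  have hsub : ∀ X : Finset V, X.Nonempty → X ≠ Finset.univ →
    ∑ e ∈ inducedEdges X, (∑ k, cycleMult (σ k) e) / 2 ≤ (X.card : ℝ) - 1 := by
    intro X hX hXu
    rw [← Finset.sum_div, Finset.sum_comm]
    -- At most one cycle is unsplit. Any two cycles cover all vertices and share some `w`. If
    -- neither were split, both would lie on the side of `w`, so `X` would be everything or empty.
    -- The bound then follows from `2 * |X|` incidences minus at least two splits, halved.
    have hns : ∀ k l, k ≠ l → ¬ IsSplit (σ k) X → IsSplit (σ l) X := by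
      intro k l hkl hk
      by_contra hl
      have hcov : ∀ v, v ∈ (σ k).support ∨ v ∈ (σ l).support := by
        intro v
        by_contra! hv
        have h1 : (Finset.univ.filter fun k => v ∈ (σ k).support) ⊆ (Finset.univ \ {k, l}) := by
          intro j hj
          simp only [mem_filter, mem_univ, true_and, mem_sdiff, mem_insert, mem_singleton] at hj ⊢
          rintro (rfl | rfl)
          · exact hv.1 hj
          · exact hv.2 hj
        have h2 := Finset.card_le_card h1
        rw [htwo, Finset.card_sdiff_of_subset (Finset.subset_univ _), Finset.card_pair hkl] at h2
        simp at h2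
      obtain ⟨w, hwk, hwl⟩ := hmeet k l
      unfold IsSplit at hk hl
      push Not at hk hl
      by_cases hw : w ∈ X
      · apply hXu
        ext v
        simp only [mem_univ, iff_true]
        rcases hcov v with h | h
        · exact hk ⟨w, hwk, hw⟩ v h
        · exact hl ⟨w, hwl, hw⟩ v h
      · obtain ⟨v, hv⟩ := hX
        rcases hcov v with h | h
        · exact hw (hk ⟨v, h, hv⟩ w hwk)
        · exact hw (hl ⟨v, h, hv⟩ w hwl)
    have hcard : (∑ k, ((σ k).support.filter (· ∈ X)).card) = 2 * X.card := by
      have : ∀ k, ((σ k).support.filter (· ∈ X)).card =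
          ∑ v ∈ X, if v ∈ (σ k).support then 1 else 0 := by
        intro k
        rw [← Finset.card_filter]
        congr 1
        ext v
        simp [and_comm]
      simp_rw [this]
      rw [Finset.sum_comm]
      simp_rw [← Finset.card_filter, htwo]
      simp [mul_comm]
    have hsplit : (2 : ℝ) ≤ ∑ k, if IsSplit (σ k) X then 1 else 0 := by
      rw [Fin.sum_univ_three]
      have h01 := hns 0 1 (by decide)
      have h02 := hns 0 2 (by decide)
      have h12 := hns 1 2 (by decide)
      split_ifs <;> first | (exfalso; tauto) | norm_num
    have hle : ∑ k, ∑ e ∈ inducedEdges X, cycleMult (σ k) e ≤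
        ∑ k, (((σ k).support.filter (· ∈ X)).card - if IsSplit (σ k) X then (1 : ℝ) else 0) :=
      Finset.sum_le_sum fun k _ => sum_induced_cycleMult_le (hσ k) X
    rw [Finset.sum_sub_distrib] at hle
    have hcard' : (∑ k, (((σ k).support.filter (· ∈ X)).card : ℝ)) = 2 * X.card := by
      exact_mod_cast hcard
    linarith
  have hnn : ∀ e, 0 ≤ (∑ k, cycleMult (σ k) e) / 2 := fun e =>
    div_nonneg (Finset.sum_nonneg fun k _ => cycleMult_nonneg _ _) (by norm_num)
  refine ⟨fun e _ => hnn e, ?_, ?_, hsub⟩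
  · intro e
    induction e using Sym2.ind with
    | _ u v =>
    intro he
    have huv := mk_mem_edges.1 he
    -- The bound `x e ≤ 1` is the subtour constraint of the two endpoints, a proper subset since
    -- there are at least three vertices.
    have hX := hsub {u, v} (by simp) (by
      intro h
      have := congrArg Finset.card h
      rw [Finset.card_pair huv, Finset.card_univ] at this
      omega)
    rw [Finset.card_pair huv] at hX
    have hmem : s(u, v) ∈ inducedEdges ({u, v} : Finset V) := by
      simp [mk_mem_inducedEdges, huv]
    have := Finset.single_le_sum (f := fun e => (∑ k, cycleMult (σ k) e) / 2)
      (fun e _ => hnn e) hmem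
    norm_num at hX
    linarith
  · intro v
    rw [← Finset.sum_div, Finset.sum_comm,
      Finset.sum_congr rfl fun k _ => sum_delta_cycleMult (σ k) v,
      ← Finset.sum_filter, Finset.sum_const, htwo]
    norm_num

lemma sum_cost_three_cycles {V : Type*} [Fintype V] [MetricSpace V] (σ : Fin 3 → Equiv.Perm V) :
    ∑ e ∈ edges V, edgeCost e * ((∑ k, cycleMult (σ k) e) / 2) =
      (∑ k, ∑ u, dist u (σ k u)) / 2 := by
  simp_rw [← sum_cost_cycleMult]
  rw [Finset.sum_comm, Finset.sum_div]
  refine Finset.sum_congr rfl fun e _ => ?_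
  rw [← Finset.mul_sum]
  ring

end ThreeCycles

/-! ### Weak duality for the subtour LP -/

section Bounds

variable {V : Type*} [Fintype V] [MetricSpace V]

lemma edgeCost_nonneg {V : Type*} [MetricSpace V] (e : Sym2 V) : 0 ≤ edgeCost e := by
  induction e using Sym2.ind with
  | _ u v => exact dist_nonneg

lemma subtourLPValue_le {x : Sym2 V → ℝ} (hx : IsSubtourFeasible x) :
    subtourLPValue V ≤ ∑ e ∈ edges V, edgeCost e * x e := by
  refine csInf_le ⟨0, ?_⟩ ⟨x, hx, rfl⟩
  rintro L ⟨y, hy, rfl⟩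
  exact Finset.sum_nonneg fun e he => mul_nonneg (edgeCost_nonneg e) (hy.nonneg e he)

/-- Disjoint moats around the vertices give a lower bound for the subtour LP. -/
lemma le_subtourLPValue (hfeas : ∃ x : Sym2 V → ℝ, IsSubtourFeasible x) (μ : V → ℝ)
    (hμ : ∀ u v, u ≠ v → μ u + μ v ≤ dist u v) :
    2 * ∑ v, μ v ≤ subtourLPValue V := by
  classical
  obtain ⟨x, hx⟩ := hfeas
  -- Feasibility matters here, as the infimum of the empty set would be 0.
  refine le_csInf ⟨_, x, hx, rfl⟩ ?_
  rintro L ⟨y, hy, rfl⟩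
  have h1 : ∀ e ∈ edges V, (∑ v, if v ∈ e then μ v * y e else 0) ≤ edgeCost e * y e := by
    intro e he
    have hy0 := hy.nonneg e he
    induction e using Sym2.ind with
    | _ u v =>
    have huv := mk_mem_edges.1 he
    have : (∑ w, if w ∈ s(u, v) then μ w * y s(u, v) else 0) = (μ u + μ v) * y s(u, v) := by
      rw [← Finset.sum_filter]
      have : (Finset.univ.filter fun w => w ∈ s(u, v)) = {u, v} := by
        ext w; simp
      rw [this, Finset.sum_pair huv]
      ring
    rw [this]
    exact mul_le_mul_of_nonneg_right (hμ u v huv) hy0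
  refine le_trans ?_ (Finset.sum_le_sum h1)
  rw [Finset.sum_comm, Finset.mul_sum]
  refine Finset.sum_le_sum fun v _ => ?_
  rw [← Finset.sum_filter, ← Finset.mul_sum]
  have := hy.degree v
  simp only [delta] at this
  rw [mul_comm]
  refine le_of_eq ?_
  congr 1
  rw [← this]

end Bounds

lemma finRotate_val {N : ℕ} (i : Fin N) : (finRotate N i : ℕ) = (i.1 + 1) % N := by
  cases N with
  | zero => exact i.elim0
  | succ N => rw [finRotate_apply, Fin.val_add]; simp

/-! ### Closed walks and shortcutting -/

section Walks

variable {V : Type*} [MetricSpace V]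

/-- The length of the walk that starts in `x` and then visits the points of a list. -/
noncomputable def walkLength : V → List V → ℝ
  | _, [] => 0
  | x, y :: l => dist x y + walkLength y l

lemma walkLength_sublist {l' l : List V} (h : l'.Sublist l) (x z : V) :
    walkLength x (l' ++ [z]) ≤ walkLength x (l ++ [z]) := by
  have htri : ∀ (l : List V) (x y : V),
      walkLength x (l ++ [z]) ≤ dist x y + walkLength y (l ++ [z]) := by
    intro l x y
    cases l with
    | nil => simpa [walkLength] using dist_triangle x y z
    | cons w l =>
      simp only [List.cons_append, walkLength]
      linarith [dist_triangle x y w]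
  induction h generalizing x with
  | slnil => rfl
  | cons y h ih =>
    simp only [List.cons_append, walkLength]
    exact (htri _ x y).trans (by gcongr; exact ih y)
  | cons_cons y h ih =>
    simp only [List.cons_append, walkLength]
    gcongr
    exact ih y

lemma walkLength_append_singleton_le (l : List V) (x y z : V) :
    walkLength x (l ++ [y]) ≤ walkLength x (l ++ [z]) + dist z y := by
  induction l generalizing x with
  | nil => simpa [walkLength] using dist_triangle x z y
  | cons w l ih =>
    simp only [List.cons_append, walkLength]
    linarith [ih w]

lemma walkLength_append_self (l : List V) (x z : V) :
    walkLength x (l ++ [z] ++ [z]) = walkLength x (l ++ [z]) := by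
  induction l generalizing x with
  | nil => simp [walkLength]
  | cons w l ih =>
    simp only [List.cons_append, walkLength]
    rw [ih w]

lemma walkLength_eq_sum (x : V) (l : List V) :
    walkLength x l = ∑ i : Fin l.length, dist ((x :: l)[i.1]'(by simp)) l[i.1] := by
  induction l generalizing x with
  | nil => simp [walkLength]
  | cons y l ih =>
    rw [walkLength, ih y]
    simp only [List.length_cons]
    rw [Fin.sum_univ_succ]
    simp

/-- Shortcutting a closed walk. -/
lemma closed_walkLength_sublist_le {l L : List V} {x z : V}
    (h : (x :: l).Sublist (L ++ [z])) :
    walkLength x (l ++ [x]) ≤ walkLength z (L ++ [z]) := by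
  -- Compare first with the closed walk from `z` through `x :: l` back to `z`. Redirecting its last
  -- edge to `x` costs at most `dist z x`, which is the first edge dropped.
  have h1 := walkLength_sublist h z z
  rw [walkLength_append_self] at h1
  simp only [List.cons_append, walkLength] at h1
  linarith [walkLength_append_singleton_le l x x z]

/-- The closed length of a list, as a sum over cyclically consecutive entries. -/
lemma closed_walkLength_eq_sum (x : V) (l : List V) :
    walkLength x (l ++ [x]) = ∑ i : Fin (x :: l).length,
      dist (x :: l)[i.1] ((x :: l)[(i.1 + 1) % (x :: l).length]'(Nat.mod_lt _ (by simp))) := by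
  rw [walkLength_eq_sum]
  refine Fintype.sum_equiv (finCongr (by simp)) _ _ fun i => ?_
  have hi : i.1 < l.length + 1 := by have := i.2; simpa using this
  simp only [finCongr_apply, Fin.val_cast]
  have h1 : (x :: (l ++ [x]))[i.1]'(by simp; omega) = (x :: l)[i.1]'(by simpa using hi) := by
    have : x :: (l ++ [x]) = (x :: l) ++ [x] := rfl
    simp only [this]
    rw [List.getElem_append_left]
  have h2 : (l ++ [x])[i.1] =
      (x :: l)[(i.1 + 1) % (x :: l).length]'(Nat.mod_lt _ (by simp)) := by
    by_cases h : i.1 < l.length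
    · have h' : (i.1 + 1) % (x :: l).length = i.1 + 1 := Nat.mod_eq_of_lt (by simpa using h)
      simp only [h']
      rw [List.getElem_append_left h]
      simp
    · have h'' : i.1 = l.length := by omega
      simp only [h'']
      simp
  rw [h1, h2]

open Classical in
lemma sum_dist_formPerm [Fintype V] (x : V) (l : List V) (hl : (x :: l).Nodup) :
    ∑ u, dist u ((x :: l).formPerm u) = walkLength x (l ++ [x]) := by
  rw [closed_walkLength_eq_sum, ← Finset.sum_subset (Finset.subset_univ (x :: l).toFinset)]
  · symm
    refine Finset.sum_bij (fun i _ => (x :: l)[i.1]) ?_ ?_ ?_ ?_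
    · intro i _
      exact List.mem_toFinset.2 (List.getElem_mem _)
    · intro i _ j _ hij
      exact Fin.ext ((List.Nodup.getElem_inj_iff hl).1 hij)
    · intro u hu
      obtain ⟨i, hi, rfl⟩ := List.getElem_of_mem (List.mem_toFinset.1 hu)
      exact ⟨⟨i, hi⟩, Finset.mem_univ _, rfl⟩
    · intro i _
      rw [List.formPerm_apply_getElem _ hl]
  · intro u _ hu
    rw [List.formPerm_apply_of_notMem (by simpa using hu), dist_self]

lemma optTourLength_le {V : Type*} [Fintype V] [MetricSpace V] (f : Fin (Fintype.card V) ≃ V) :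
    optTourLength V ≤ tourLength f := by
  refine csInf_le ⟨0, ?_⟩ ⟨f, rfl⟩
  rintro L ⟨g, rfl⟩
  exact Finset.sum_nonneg fun _ _ => dist_nonneg

/-- A closed walk through all vertices can be shortcut to a tour. -/
lemma optTourLength_le_walkLength [Fintype V] {z : V} {L : List V}
    (hL : ∀ v, v ∈ L ++ [z]) : optTourLength V ≤ walkLength z (L ++ [z]) := by
  classical
  obtain ⟨x, l, hxl⟩ : ∃ x l, (L ++ [z]).dedup = x :: l := by
    have : z ∈ (L ++ [z]).dedup := List.mem_dedup.2 (hL z)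
    cases h : (L ++ [z]).dedup with
    | nil => rw [h] at this; simp at this
    | cons x l => exact ⟨x, l, rfl⟩
  have hnd : (x :: l).Nodup := hxl ▸ List.nodup_dedup _
  have hmem : ∀ v, v ∈ x :: l := fun v => hxl ▸ List.mem_dedup.2 (hL v)
  have hcard : Fintype.card V = (x :: l).length := by
    rw [← List.toFinset_card_of_nodup hnd, ← Finset.card_univ]
    congr 1
    ext v
    simpa using hmem v
  have hle : walkLength x (l ++ [x]) ≤ walkLength z (L ++ [z]) :=
    closed_walkLength_sublist_le (hxl ▸ List.dedup_sublist _)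
  refine le_trans ?_ hle
  refine (optTourLength_le ((finCongr hcard).trans (hnd.getEquivOfForallMemList _ hmem))).trans
    (le_of_eq ?_)
  rw [closed_walkLength_eq_sum, tourLength]
  refine Fintype.sum_equiv (finCongr hcard) _ _ fun i => ?_
  have hrot : ((finRotate (Fintype.card V)) i : ℕ) = (i.1 + 1) % (x :: l).length := by
    rw [finRotate_val]
    exact congrArg _ hcard
  simp only [Equiv.trans_apply, finCongr_apply, List.Nodup.getEquivOfForallMemList_apply,
    List.get_eq_getElem, Fin.val_cast, hrot]

end Walks

/-! ### Tours as permutations without proper invariant sets -/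

section Tours

variable {V : Type*} [Fintype V] [MetricSpace V]

/-- An optimum tour, seen as the permutation that maps each vertex to its successor. -/
lemma exists_perm_tour :
    ∃ σ : Equiv.Perm V, (∑ v, dist v (σ v)) = optTourLength V ∧
      ∀ X : Finset V, X.Nonempty → (∀ v ∈ X, σ v ∈ X) → X = Finset.univ := by
  classical
  have hne : {L : ℝ | ∃ f : Fin (Fintype.card V) ≃ V, L = tourLength f}.Nonempty :=
    ⟨_, (Fintype.equivFin V).symm, rfl⟩
  have hfin : {L : ℝ | ∃ f : Fin (Fintype.card V) ≃ V, L = tourLength f}.Finite := by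
    refine (Set.finite_range (fun f : Fin (Fintype.card V) ≃ V => tourLength f)).subset ?_
    rintro L ⟨f, rfl⟩
    exact ⟨f, rfl⟩
  obtain ⟨f, hf⟩ := hne.csInf_mem hfin
  refine ⟨f.symm.trans ((finRotate _).trans f), ?_, ?_⟩
  · rw [optTourLength, hf, tourLength]
    exact Fintype.sum_equiv f.symm _ _ fun v => by simp
  · intro X hX hclosed
    obtain ⟨v₀, hv₀⟩ := hX
    -- The cardinality is generalized to `N` so that it can be split into zero and successor.
    have key : ∀ (N : ℕ) (f : Fin N ≃ V), (∀ v ∈ X, f (finRotate N (f.symm v)) ∈ X) →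
        X = Finset.univ := by
      intro N f hc
      rcases N with _ | N
      · exact (f.symm v₀).elim0
      have hstep : ∀ k : ℕ, f ((finRotate (N + 1) ^ k) (f.symm v₀)) ∈ X := by
        intro k
        induction k with
        | zero => simpa using hv₀
        | succ k ih =>
          have := hc _ ih
          rwa [Equiv.symm_apply_apply, ← Equiv.Perm.mul_apply, ← pow_succ'] at this
      have hpow : ∀ (k : ℕ) (i : Fin (N + 1)),
          (((finRotate (N + 1) ^ k) i : Fin (N + 1)) : ℕ) = (i.1 + k) % (N + 1) := by
        intro k i
        induction k with
        | zero => simp [Nat.mod_eq_of_lt i.2]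
        | succ k ih =>
          rw [pow_succ', Equiv.Perm.mul_apply, finRotate_val, ih]
          simp [Nat.add_assoc]
      ext v
      simp only [Finset.mem_univ, iff_true]
      have h := hstep ((f.symm v).1 + (N + 1 - (f.symm v₀).1))
      have : (finRotate (N + 1) ^ ((f.symm v).1 + (N + 1 - (f.symm v₀).1))) (f.symm v₀) =
          f.symm v := by
        apply Fin.ext
        rw [hpow]
        have h1 := (f.symm v₀).2
        have h2 := (f.symm v).2
        have : (f.symm v₀).1 + ((f.symm v).1 + (N + 1 - (f.symm v₀).1)) =
          (f.symm v).1 + (N + 1) := by omega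
        rw [this, Nat.add_mod_right, Nat.mod_eq_of_lt h2]
      rw [this] at h
      simpa using h
    exact key _ f hclosed

end Tours

/-! ### Integrating and parity of crossings -/

section Crossings

/-- Integrate the covering inequality over `[0, r)`; each weighted interval integrates to at most
its weight times its length. -/
lemma mul_le_sum_of_cover {ι : Type*} (s : Finset ι) (w α β : ι → ℝ) (hw : ∀ i ∈ s, 0 ≤ w i)
    (hαβ : ∀ i ∈ s, α i ≤ β i) {r c : ℝ} (hr : 0 ≤ r)
    (h : ∀ ρ, 0 ≤ ρ → ρ < r → c ≤ ∑ i ∈ s, (Set.Ico (α i) (β i)).indicator (fun _ => w i) ρ) :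
    c * r ≤ ∑ i ∈ s, w i * (β i - α i) := by
  classical
  set F : ℝ → ℝ := fun ρ => ∑ i ∈ s, (Set.Ico (α i) (β i)).indicator (fun _ => w i) ρ with hF
  have hint : ∀ i, MeasureTheory.Integrable
      ((Set.Ico (α i) (β i)).indicator fun _ => w i) := fun i =>
    (MeasureTheory.integrable_indicator_iff measurableSet_Ico).2 (by simp)
  have hFint : MeasureTheory.Integrable F := MeasureTheory.integrable_finsetSum _ fun i _ => hint i
  have h1 : ∫ _ρ in Set.Ico 0 r, c ≤ ∫ ρ in Set.Ico 0 r, F ρ := by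
    refine MeasureTheory.setIntegral_mono_on (by simp) hFint.integrableOn measurableSet_Ico ?_
    exact fun ρ hρ => h ρ hρ.1 hρ.2
  have h2 : ∫ ρ in Set.Ico 0 r, F ρ ≤ ∫ ρ, F ρ := by
    refine MeasureTheory.setIntegral_le_integral hFint (Filter.Eventually.of_forall fun ρ => ?_)
    exact Finset.sum_nonneg fun i hi => Set.indicator_nonneg (fun _ _ => hw i hi) _
  have h3 : ∫ ρ, F ρ = ∑ i ∈ s, w i * (β i - α i) := by
    rw [hF, MeasureTheory.integral_finsetSum _ fun i _ => hint i]
    refine Finset.sum_congr rfl fun i hi => ?_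
    rw [MeasureTheory.integral_indicator measurableSet_Ico]
    simp [hαβ i hi, mul_comm]
  have h4 : ∫ _ρ in Set.Ico 0 r, c = c * r := by
    simp [hr, mul_comm]
  linarith

open Classical in
-- With signs `s` for the two sides, the product of `s v * s (σ v)` is a square because `σ` is
-- bijective, and each crossing contributes a factor `-1`.
lemma even_card_crossing {V : Type*} [Fintype V] (σ : Equiv.Perm V) (S : V → Prop) :
    Even (Finset.univ.filter fun v => ¬ (S v ↔ S (σ v))).card := by
  let s : V → ℤ := fun v => if S v then 1 else -1
  have hs : ∀ v, s v * s v = 1 := fun v => by simp only [s]; split_ifs <;> norm_num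
  have h1 : ∏ v, s v * s (σ v) = 1 := by
    rw [Finset.prod_mul_distrib, Equiv.prod_comp σ s, ← Finset.prod_mul_distrib]
    exact Finset.prod_eq_one fun v _ => hs v
  have h2 : ∏ v, s v * s (σ v) = ∏ v, if ¬ (S v ↔ S (σ v)) then (-1 : ℤ) else 1 := by
    refine Finset.prod_congr rfl fun v _ => ?_
    simp only [s]
    by_cases h : S v <;> by_cases h' : S (σ v) <;> simp [h, h']
  rw [h1, Finset.prod_ite, Finset.prod_const, Finset.prod_const_one, mul_one] at h2
  exact (neg_one_pow_eq_one_iff_even (by norm_num)).1 h2.symm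

end Crossings

/-- Four corners, any two of which are joined by a subdivided segment, in a finite metric space.
`pt a b j` is the `j`-th vertex on the segment from corner `a` to corner `b`, which has `K a b`
parts of length `h a b`. The balls with radii `r` around the corners cover the segments. -/
structure Network (V : Type*) [Fintype V] [MetricSpace V] where
  corner : Fin 4 → V
  pt : Fin 4 → Fin 4 → ℕ → V
  K : Fin 4 → Fin 4 → ℕ
  h : Fin 4 → Fin 4 → ℝ
  r : Fin 4 → ℝ
  K_symm : ∀ a b, K a b = K b a
  two_le_K : ∀ a b, 2 ≤ K a b
  h_pos : ∀ a b, 0 < h a b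
  h_le_one : ∀ a b, h a b ≤ 1
  r_pos : ∀ a, 0 < r a
  r_add : ∀ a b, a ≠ b → r a + r b = K a b * h a b
  pt_zero : ∀ a b, pt a b 0 = corner a
  pt_rev : ∀ a b j, j ≤ K a b → pt b a j = pt a b (K a b - j)
  dist_pt : ∀ a b, a ≠ b → ∀ i j, i ≤ K a b → j ≤ K a b →
    dist (pt a b i) (pt a b j) = |(i : ℝ) - j| * h a b
  -- Quantitative disjointness of segments away from their ends. It is used with `R = h a b`
  -- (segments meet only in ends), `R = 4` (nearest neighbors lie on the same segment) and large `R`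
  -- (edges between segments are long).
  sep : ∀ a b c d, a ≠ b → c ≠ d → s(a, b) ≠ s(c, d) → ∀ i j, i ≤ K a b → j ≤ K c d →
    ∀ R : ℝ, R ≤ i * h a b → R ≤ (K a b - i) * h a b → R / 4 ≤ dist (pt a b i) (pt c d j)
  cover : ∀ v, ∃ a b, a ≠ b ∧ ∃ j, j ≤ K a b ∧ v = pt a b j

/-! ### Circles around the corners and the crossings of a tour -/

namespace Network

variable {V : Type*} [Fintype V] [MetricSpace V] (T : Network V)

lemma pt_K (a b : Fin 4) : T.pt a b (T.K a b) = T.corner b := by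
  have := T.pt_rev a b 0 (Nat.zero_le _)
  rw [T.pt_zero, Nat.sub_zero] at this
  exact this.symm

lemma dist_corner_pt {a b : Fin 4} (hab : a ≠ b) {j : ℕ} (hj : j ≤ T.K a b) :
    dist (T.corner a) (T.pt a b j) = j * T.h a b := by
  rw [← T.pt_zero a b, T.dist_pt a b hab 0 j (Nat.zero_le _) hj]
  simp

lemma dist_corner {a b : Fin 4} (hab : a ≠ b) :
    dist (T.corner a) (T.corner b) = T.r a + T.r b := by
  rw [← T.pt_K a b, T.dist_corner_pt hab le_rfl, T.r_add a b hab]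

lemma corner_injective : Function.Injective T.corner := by
  intro a b h
  by_contra hab
  have := T.dist_corner hab
  rw [h, dist_self] at this
  linarith [T.r_pos a, T.r_pos b]

lemma pt_injOn {a b : Fin 4} (hab : a ≠ b) {i j : ℕ} (hi : i ≤ T.K a b) (hj : j ≤ T.K a b)
    (h : T.pt a b i = T.pt a b j) : i = j := by
  have := T.dist_pt a b hab i j hi hj
  rw [h, dist_self] at this
  have h2 := mul_eq_zero.1 this.symm
  rcases h2 with h2 | h2
  · rw [abs_eq_zero, sub_eq_zero] at h2
    exact_mod_cast h2
  · exact absurd h2 (T.h_pos a b).ne'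

lemma eq_end_of_pt_eq {a b c d : Fin 4} (hab : a ≠ b) (hcd : c ≠ d) (hne : s(a, b) ≠ s(c, d))
    {i j : ℕ} (hi : i ≤ T.K a b) (hj : j ≤ T.K c d) (h : T.pt a b i = T.pt c d j) :
    i = 0 ∨ i = T.K a b := by
  by_contra! hc
  have hh := T.h_pos a b
  have h1 : (1 : ℝ) ≤ i := by exact_mod_cast Nat.one_le_iff_ne_zero.2 hc.1
  have h2 : (1 : ℝ) ≤ T.K a b - i := by
    have : i + 1 ≤ T.K a b := by omega
    have : (i : ℝ) + 1 ≤ T.K a b := by exact_mod_cast this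
    linarith
  have := T.sep a b c d hab hcd hne i j hi hj (T.h a b) (by nlinarith) (by nlinarith)
  rw [h, dist_self] at this
  linarith

lemma corner_eq_pt {a b c : Fin 4} (hbc : b ≠ c) {j : ℕ} (hj : j ≤ T.K b c)
    (h : T.corner a = T.pt b c j) : a = b ∨ a = c := by
  by_contra! hc
  obtain ⟨hab, hac⟩ := hc
  have hne : s(b, c) ≠ s(b, a) := by
    intro h
    rcases Sym2.eq_iff.1 h with ⟨_, h⟩ | ⟨h, _⟩
    · exact hac h.symm
    · exact hab h.symm
  rcases T.eq_end_of_pt_eq hbc hab.symm hne hj le_rfl (h.symm.trans (T.pt_K b a).symm) with h0 | h0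
  · rw [h0, T.pt_zero] at h
    exact hab (T.corner_injective h)
  · rw [h0, T.pt_K] at h
    exact hac (T.corner_injective h)

lemma eq_zero_of_pt_eq {a b c : Fin 4} (hab : a ≠ b) (hac : a ≠ c) (hbc : b ≠ c)
    {i j : ℕ} (hi : i ≤ T.K a b) (hj : j ≤ T.K a c) (h : T.pt a b i = T.pt a c j) : i = 0 := by
  have hne : s(a, b) ≠ s(a, c) := by
    intro h
    rcases Sym2.eq_iff.1 h with ⟨_, h⟩ | ⟨h, _⟩
    · exact hbc h
    · exact hac h
  rcases T.eq_end_of_pt_eq hab hac hne hi hj h with h0 | h0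
  · exact h0
  · rw [h0, T.pt_K] at h
    rcases T.corner_eq_pt hac hj h with h | h
    · exact absurd h.symm hab
    · exact absurd h hbc

/-- The distance to corner `a`, truncated at `r a`. -/
noncomputable def trunc (a : Fin 4) (v : V) : ℝ := min (dist (T.corner a) v) (T.r a)

lemma trunc_eq_of_trunc_lt {a b : Fin 4} (hab : a ≠ b) {v : V} (h : T.trunc a v < T.r a) :
    T.trunc b v = T.r b := by
  have h1 : dist (T.corner a) v < T.r a := by
    by_contra! hc
    rw [trunc, min_eq_right hc] at h
    exact lt_irrefl _ h
  have h2 := dist_triangle_right (T.corner a) (T.corner b) v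
  rw [T.dist_corner hab] at h2
  exact min_eq_right (by linarith)

lemma abs_trunc_sub_le (a : Fin 4) (u v : V) : |T.trunc a u - T.trunc a v| ≤ dist u v := by
  refine (abs_min_sub_min_le_max _ _ _ _).trans (max_le ?_ (by simp))
  rw [dist_comm _ u, dist_comm _ v]
  exact abs_dist_sub_le u v _

lemma trunc_le (a : Fin 4) (v : V) : T.trunc a v ≤ T.r a := min_le_right _ _

lemma le_trunc_add {a b : Fin 4} (hab : a ≠ b) {u v : V} (hu : T.trunc a u < T.r a)
    (hv : T.trunc b v < T.r b) :
    (T.r a - T.trunc a u) + (T.r b - T.trunc b v) ≤ dist u v := by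
  have hu' : T.trunc a u = dist (T.corner a) u := by
    rcases min_choice (dist (T.corner a) u) (T.r a) with h | h
    · exact h
    · exact absurd h hu.ne
  have hv' : T.trunc b v = dist (T.corner b) v := by
    rcases min_choice (dist (T.corner b) v) (T.r b) with h | h
    · exact h
    · exact absurd h hv.ne
  rw [hu', hv']
  have h1 := T.dist_corner hab
  have h2 := dist_triangle4 (T.corner a) u v (T.corner b)
  rw [dist_comm v (T.corner b)] at h2
  linarith

/-- The open balls are disjoint, so each endpoint lies in at most one. For endpoints in different
balls, the two radial spans fit into `dist u v` by the triangle inequality between the centers;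
otherwise at most one summand is nonzero. -/
lemma sum_abs_trunc_sub_le (u v : V) : ∑ a, |T.trunc a u - T.trunc a v| ≤ dist u v := by
  have hsingle : ∀ b, (∀ a, a ≠ b → T.trunc a u = T.r a ∧ T.trunc a v = T.r a) →
      ∑ a, |T.trunc a u - T.trunc a v| ≤ dist u v := by
    intro b hb
    rw [Finset.sum_eq_single b]
    · exact T.abs_trunc_sub_le b u v
    · intro a _ hab
      simp [(hb a hab).1, (hb a hab).2]
    · simp
  have hout : ∀ {a} {w : V}, ¬ T.trunc a w < T.r a → T.trunc a w = T.r a := fun h =>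
    le_antisymm (T.trunc_le _ _) (not_lt.1 h)
  by_cases hu : ∃ a, T.trunc a u < T.r a
  · obtain ⟨a, hau⟩ := hu
    by_cases hv : ∃ b, b ≠ a ∧ T.trunc b v < T.r b
    · obtain ⟨b, hba, hbv⟩ := hv
      have key := T.le_trunc_add hba.symm hau hbv
      rw [← Finset.sum_subset (Finset.subset_univ {a, b})]
      · rw [Finset.sum_pair hba.symm, T.trunc_eq_of_trunc_lt hba hbv,
          T.trunc_eq_of_trunc_lt hba.symm hau, abs_sub_comm, abs_of_nonneg, abs_of_nonneg]
        · exact key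
        · linarith
        · linarith
      · intro c _ hc
        simp only [mem_insert, mem_singleton, not_or] at hc
        rw [T.trunc_eq_of_trunc_lt (Ne.symm hc.1) hau, T.trunc_eq_of_trunc_lt (Ne.symm hc.2) hbv]
        simp
    · push Not at hv
      exact hsingle a fun c hc => ⟨T.trunc_eq_of_trunc_lt hc.symm hau,
        le_antisymm (T.trunc_le _ _) (hv c hc)⟩
  · push Not at hu
    by_cases hv : ∃ b, T.trunc b v < T.r b
    · obtain ⟨b, hbv⟩ := hv
      exact hsingle b fun c hc => ⟨le_antisymm (T.trunc_le _ _) (hu c),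
        T.trunc_eq_of_trunc_lt hc.symm hbv⟩
    · push Not at hv
      exact hsingle 0 fun c _ => ⟨le_antisymm (T.trunc_le _ _) (hu c),
        le_antisymm (T.trunc_le _ _) (hv c)⟩

lemma trunc_pt_le {a b : Fin 4} (hab : a ≠ b) {i : ℕ} (hi : i ≤ T.K a b) {ρ : ℝ} (hρ : ρ < T.r a) :
    T.trunc a (T.pt a b i) ≤ ρ ↔ i * T.h a b ≤ ρ := by
  rw [trunc, T.dist_corner_pt hab hi, min_le_iff]
  simp [not_le.2 hρ]

open Classical in
/-- The gaps of the arm from `a` to `b`: the parts of the segment that are not spanned by any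
tour edge with both endpoints on the segment. -/
noncomputable def gaps (σ : Equiv.Perm V) (a b : Fin 4) : Finset ℕ :=
  (Finset.range (T.K a b)).filter fun j =>
    ∀ i i', i ≤ T.K a b → i' ≤ T.K a b → σ (T.pt a b i) = T.pt a b i' → (i ≤ j ↔ i' ≤ j)

open Classical in
/-- Every circle around a corner that avoids the gaps is crossed at least four times. -/
lemma four_le_crossings (σ : Equiv.Perm V) (a : Fin 4) {ρ : ℝ} (h0 : 0 ≤ ρ) (hρ : ρ < T.r a)
    (hgap : ∀ b, a ≠ b → ⌊ρ / T.h a b⌋₊ ∉ T.gaps σ a b) :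
    4 ≤ (Finset.univ.filter fun v => ¬ (T.trunc a v ≤ ρ ↔ T.trunc a (σ v) ≤ ρ)).card := by
  have hex : ∀ b, ∃ i i', a ≠ b → i ≤ T.K a b ∧ i' ≤ T.K a b ∧
      σ (T.pt a b i) = T.pt a b i' ∧ i ≠ i' ∧
      ¬ (T.trunc a (T.pt a b i) ≤ ρ ↔ T.trunc a (T.pt a b i') ≤ ρ) := by
    intro b
    by_cases hab : a = b
    · exact ⟨0, 0, fun h => absurd hab h⟩
    have hh := T.h_pos a b
    have hlt : ⌊ρ / T.h a b⌋₊ < T.K a b := by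
      rw [Nat.floor_lt (by positivity), div_lt_iff₀ hh, ← T.r_add a b hab]
      linarith [T.r_pos b]
    have := hgap b hab
    simp only [gaps, mem_filter, mem_range, hlt, true_and] at this
    push Not at this
    obtain ⟨i, i', hi, hi', hσ, hne⟩ := this
    refine ⟨i, i', fun _ => ⟨hi, hi', hσ, ?_, ?_⟩⟩
    · rintro rfl
      omega
    · have hfl : ∀ k : ℕ, k ≤ ⌊ρ / T.h a b⌋₊ ↔ k * T.h a b ≤ ρ := fun k => by
        rw [Nat.le_floor_iff (by positivity), le_div_iff₀ hh]
      rw [T.trunc_pt_le hab hi hρ, T.trunc_pt_le hab hi' hρ, ← hfl, ← hfl]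
      omega
  choose i i' hii using hex
  set C := Finset.univ.filter fun v => ¬ (T.trunc a v ≤ ρ ↔ T.trunc a (σ v) ≤ ρ) with hC
  have h3 : (Finset.univ.erase a).card ≤ C.card := by
    -- The crossing edges of different arms have different tails: a common tail would be the corner
    -- `a`, and so would the common head, but the indices of tail and head differ.
    refine Finset.card_le_card_of_injOn (fun b => T.pt a b (i b)) ?_ ?_
    · intro b hb
      have hab : a ≠ b := (Finset.ne_of_mem_erase hb).symm
      obtain ⟨_, _, h3, _, h5⟩ := hii b hab
      simp only [hC, coe_filter, mem_univ, true_and, Set.mem_ofPred_eq, h3]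
      exact h5
    · intro b hb c hc hbc
      have hab : a ≠ b := (Finset.ne_of_mem_erase hb).symm
      have hac : a ≠ c := (Finset.ne_of_mem_erase hc).symm
      by_contra hne
      obtain ⟨b1, b2, b3, b4, b5⟩ := hii b hab
      obtain ⟨c1, c2, c3, c4, c5⟩ := hii c hac
      simp only at hbc
      apply b4
      rw [T.eq_zero_of_pt_eq hab hac hne b1 c1 hbc,
        T.eq_zero_of_pt_eq hab hac hne b2 c2 (by rw [← b3, ← c3, hbc])]
  have h4 : (Finset.univ.erase a).card = 3 := by
    rw [Finset.card_erase_of_mem (Finset.mem_univ _)]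
    rfl
  have heven : Even C.card := even_card_crossing σ fun v => T.trunc a v ≤ ρ
  rw [h4] at h3
  obtain ⟨k, hk⟩ := heven
  omega

lemma four_mul_r_le (σ : Equiv.Perm V) (a : Fin 4) :
    4 * T.r a ≤ (∑ v, |T.trunc a v - T.trunc a (σ v)|) +
      4 * ∑ b ∈ Finset.univ.erase a, T.h a b * (T.gaps σ a b).card := by
  classical
  set G : Finset (Σ _ : Fin 4, ℕ) := (Finset.univ.erase a).sigma fun b => T.gaps σ a b
  -- A tour edge covers the radii it crosses with weight 1. A gap covers its radii with weight 4,
  -- which alone suffices there.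
  have key := mul_le_sum_of_cover ((Finset.univ : Finset V).disjSum G)
    (Sum.elim (fun _ => 1) fun _ => 4)
    (Sum.elim (fun v => min (T.trunc a v) (T.trunc a (σ v))) fun p => p.2 * T.h a p.1)
    (Sum.elim (fun v => max (T.trunc a v) (T.trunc a (σ v))) fun p => (p.2 + 1) * T.h a p.1)
    (r := T.r a) (c := 4) ?_ ?_ (T.r_pos a).le ?_
  · rw [Finset.sum_disjSum, Finset.sum_sigma] at key
    refine key.trans (le_of_eq ?_)
    simp only [Sum.elim_inl, Sum.elim_inr, Finset.mul_sum]
    congr 1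
    · refine Finset.sum_congr rfl fun v _ => ?_
      rw [max_sub_min_eq_abs', one_mul]
    · refine Finset.sum_congr rfl fun b _ => ?_
      rw [Finset.sum_congr rfl fun (j : ℕ) _ =>
        show (4 : ℝ) * ((j + 1) * T.h a b - j * T.h a b) = 4 * T.h a b by ring]
      rw [Finset.sum_const, nsmul_eq_mul]
      ring
  · rintro (v | p) _ <;> norm_num
  · rintro (v | p) _
    · exact min_le_max
    · have := T.h_pos a p.1
      simp only [Sum.elim_inr]
      nlinarith
  · intro ρ h0 hρ
    rw [Finset.sum_disjSum]
    have hnn1 : ∀ v ∈ Finset.univ, 0 ≤ (Set.Ico (min (T.trunc a v) (T.trunc a (σ v)))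
        (max (T.trunc a v) (T.trunc a (σ v)))).indicator (fun _ => (1 : ℝ)) ρ :=
      fun v _ => Set.indicator_nonneg (fun _ _ => zero_le_one) _
    have hnn2 : ∀ p ∈ G, 0 ≤ (Set.Ico ((p.2 : ℝ) * T.h a p.1) ((p.2 + 1) * T.h a p.1)).indicator
        (fun _ => (4 : ℝ)) ρ := fun p _ => Set.indicator_nonneg (fun _ _ => by norm_num) _
    change 4 ≤ (∑ v, (Set.Ico (min (T.trunc a v) (T.trunc a (σ v)))
        (max (T.trunc a v) (T.trunc a (σ v)))).indicator (fun _ => (1 : ℝ)) ρ) +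
      ∑ p ∈ G, (Set.Ico ((p.2 : ℝ) * T.h a p.1) ((p.2 + 1) * T.h a p.1)).indicator
        (fun _ => (4 : ℝ)) ρ
    by_cases hgap : ∀ b, a ≠ b → ⌊ρ / T.h a b⌋₊ ∉ T.gaps σ a b
    · have h4 := T.four_le_crossings σ a h0 hρ hgap
      have : (∑ v, (Set.Ico (min (T.trunc a v) (T.trunc a (σ v)))
          (max (T.trunc a v) (T.trunc a (σ v)))).indicator (fun _ => (1 : ℝ)) ρ) =
          (Finset.univ.filter fun v => ¬ (T.trunc a v ≤ ρ ↔ T.trunc a (σ v) ≤ ρ)).card := by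
        simp only [Set.indicator_apply]
        rw [← Finset.sum_filter, Finset.sum_const, nsmul_eq_mul, mul_one]
        congr 2
        ext v
        simp only [mem_filter, mem_univ, true_and, Set.mem_Ico, min_le_iff, ← not_le,
          max_le_iff]
        tauto
      rw [this]
      have h4' : (4 : ℝ) ≤
        (Finset.univ.filter fun v => ¬ (T.trunc a v ≤ ρ ↔ T.trunc a (σ v) ≤ ρ)).card := by
        exact_mod_cast h4
      linarith [Finset.sum_nonneg hnn2]
    · push Not at hgap
      obtain ⟨b, hab, hb⟩ := hgap
      have hh := T.h_pos a b
      have hmem : (⟨b, ⌊ρ / T.h a b⌋₊⟩ : Σ _ : Fin 4, ℕ) ∈ G :=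
        Finset.mem_sigma.2 ⟨Finset.mem_erase.2 ⟨hab.symm, Finset.mem_univ _⟩, hb⟩
      have := Finset.single_le_sum hnn2 hmem
      rw [Set.indicator_of_mem] at this
      · linarith [Finset.sum_nonneg hnn1]
      · constructor
        · exact (le_div_iff₀ hh).1 (Nat.floor_le (by positivity))
        · exact (div_lt_iff₀ hh).1 (Nat.lt_floor_add_one _)

lemma four_mul_sum_r_le (σ : Equiv.Perm V) :
    4 * ∑ a, T.r a ≤ (∑ v, dist v (σ v)) +
      4 * ∑ a, ∑ b ∈ Finset.univ.erase a, T.h a b * (T.gaps σ a b).card := by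
  have h1 := Finset.sum_le_sum fun a (_ : a ∈ Finset.univ) => T.four_mul_r_le σ a
  rw [← Finset.mul_sum, Finset.sum_add_distrib, Finset.sum_comm, ← Finset.mul_sum] at h1
  have h2 := Finset.sum_le_sum fun v (_ : v ∈ Finset.univ) => T.sum_abs_trunc_sub_le v (σ v)
  linarith

end Network

/-! ### Bounding the gaps of a tour -/

namespace Network

variable {V : Type*} [Fintype V] [MetricSpace V] (T : Network V)

section Far

/-- The vertex `pt a b j` has distance at least `R` from both ends of its segment. -/
def IsFar (a b : Fin 4) (R : ℝ) (j : ℕ) : Prop :=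
  R ≤ j * T.h a b ∧ R ≤ (T.K a b - j) * T.h a b

open Classical in
-- At most `⌈R / h⌉` indices are close to each end, and rounding costs at most one part, of length
-- at most 1.
lemma h_mul_card_not_far_le (a b : Fin 4) {R : ℝ} (hR : 0 < R) :
    T.h a b * ((Finset.range (T.K a b)).filter fun j => ¬ T.IsFar a b R j).card ≤ 2 * (R + 1) := by
  have hh := T.h_pos a b
  set N := ⌈R / T.h a b⌉₊
  have hN : T.h a b * N ≤ R + 1 := by
    have h1 : (N : ℝ) < R / T.h a b + 1 := Nat.ceil_lt_add_one (by positivity)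
    have h2 : T.h a b * N < T.h a b * (R / T.h a b + 1) := mul_lt_mul_of_pos_left h1 hh
    rw [mul_add, mul_div_cancel₀ _ hh.ne'] at h2
    linarith [T.h_le_one a b]
  have h1 : ((Finset.range (T.K a b)).filter fun j : ℕ => ¬ R ≤ j * T.h a b).card ≤ N := by
    rw [← Finset.card_range N]
    refine Finset.card_le_card fun j hj => ?_
    simp only [mem_filter, mem_range, not_le] at hj ⊢
    exact Nat.lt_ceil.2 ((lt_div_iff₀ hh).2 hj.2)
  have h2 : ((Finset.range (T.K a b)).filter
      fun j : ℕ => ¬ R ≤ (T.K a b - j) * T.h a b).card ≤ N := by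
    rw [← Finset.card_range N]
    refine Finset.card_le_card_of_injOn (fun j => T.K a b - j) ?_ ?_
    · intro j hj
      simp only [coe_filter, mem_range, not_le, Set.mem_ofPred_eq, coe_range, Set.mem_Iio]
        at hj ⊢
      refine Nat.lt_ceil.2 ((lt_div_iff₀ hh).2 ?_)
      rw [Nat.cast_sub hj.1.le]
      exact hj.2
    · intro i hi j hj hij
      simp only [coe_filter, mem_range, not_le, Set.mem_ofPred_eq] at hi hj hij
      omega
  have h3 : ((Finset.range (T.K a b)).filter fun j => ¬ T.IsFar a b R j).card ≤ N + N := by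
    refine le_trans (Finset.card_le_card ?_) ((Finset.card_union_le _ _).trans (add_le_add h1 h2))
    intro j hj
    rw [mem_filter, IsFar] at hj
    rw [mem_union, mem_filter, mem_filter]
    tauto
  have h4 : (((Finset.range (T.K a b)).filter fun j => ¬ T.IsFar a b R j).card : ℝ) ≤ N + N := by
    exact_mod_cast h3
  nlinarith

lemma IsFar.div_four_le {T : Network V} {a b c d : Fin 4} {R : ℝ} {i j : ℕ}
    (hf : T.IsFar a b R i) (hab : a ≠ b) (hcd : c ≠ d) (hne : s(a, b) ≠ s(c, d))
    (hi : i ≤ T.K a b) (hj : j ≤ T.K c d) : R / 4 ≤ dist (T.pt a b i) (T.pt c d j) :=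
  T.sep a b c d hab hcd hne i j hi hj R hf.1 hf.2

open Classical in
/-- Consecutive gaps enclose a block of vertices that the tour has to leave. -/
lemma exists_exit {σ : Equiv.Perm V}
    (hσ : ∀ X : Finset V, X.Nonempty → (∀ v ∈ X, σ v ∈ X) → X = Finset.univ)
    {a b : Fin 4} (hab : a ≠ b) {j j' : ℕ} (hj : j ∈ T.gaps σ a b) (hj' : j' ∈ T.gaps σ a b)
    (hlt : j < j') :
    ∃ t, j < t ∧ t ≤ j' ∧ ∀ i, i ≤ T.K a b → σ (T.pt a b t) ≠ T.pt a b i := by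
  simp only [gaps, mem_filter, mem_range] at hj hj'
  by_contra! hc
  -- Without an exit the block strictly after `j` up to `j'` is invariant, since edges within the
  -- segment cross neither gap. But it misses the vertex with index 0.
  have hX := hσ ((Finset.Ioc j j').image (T.pt a b))
    ((Finset.nonempty_Ioc.2 hlt).image _) ?_
  · have h0 : T.pt a b 0 ∈ (Finset.Ioc j j').image (T.pt a b) := hX ▸ Finset.mem_univ _
    obtain ⟨t, ht, h⟩ := Finset.mem_image.1 h0
    rw [Finset.mem_Ioc] at ht
    have := T.pt_injOn hab (by omega) (Nat.zero_le _) h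
    omega
  · intro v hv
    obtain ⟨t, ht, rfl⟩ := Finset.mem_image.1 hv
    rw [Finset.mem_Ioc] at ht
    obtain ⟨i, hi, h⟩ := hc t ht.1 ht.2
    have h1 := hj.2 t i (by omega) hi h
    have h2 := hj'.2 t i (by omega) hi h
    rw [h]
    exact Finset.mem_image_of_mem _ (Finset.mem_Ioc.2 ⟨by omega, by omega⟩)

/-- Gaps near the ends account for `2 * (R + 1)`. The far gaps outnumber the far exits `W` by at
most one, and each exit edge has length at least `R / 4`, so the tour length bounds `W`. -/
lemma h_mul_card_gaps_le {σ : Equiv.Perm V}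
    (hσ : ∀ X : Finset V, X.Nonempty → (∀ v ∈ X, σ v ∈ X) → X = Finset.univ)
    {a b : Fin 4} (hab : a ≠ b) {R : ℝ} (hR : 0 < R) :
    T.h a b * (T.gaps σ a b).card ≤ 2 * (R + 1) + 1 + 4 * (∑ v, dist v (σ v)) / R := by
  classical
  set W := (Finset.range (T.K a b)).filter fun t => T.IsFar a b R t ∧
    ∀ i, i ≤ T.K a b → σ (T.pt a b t) ≠ T.pt a b i with hW
  have hWle : (W.card : ℝ) ≤ 4 * (∑ v, dist v (σ v)) / R := by
    have h1 : ∀ t ∈ W, R / 4 ≤ dist (T.pt a b t) (σ (T.pt a b t)) := by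
      intro t ht
      simp only [hW, mem_filter, mem_range] at ht
      obtain ⟨htK, hfar, hout⟩ := ht
      obtain ⟨c, d, hcd, i, hi, h⟩ := T.cover (σ (T.pt a b t))
      rw [h]
      refine hfar.div_four_le hab hcd ?_ htK.le hi
      intro heq
      rcases Sym2.eq_iff.1 heq with ⟨rfl, rfl⟩ | ⟨rfl, rfl⟩
      · exact hout i hi h
      · refine hout _ (Nat.sub_le _ i) (h.trans ?_)
        rw [T.pt_rev _ _ _ (T.K_symm a b ▸ hi)]
    have h2 := Finset.sum_le_sum h1
    rw [Finset.sum_const, nsmul_eq_mul] at h2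
    have h3 : ∑ t ∈ W, dist (T.pt a b t) (σ (T.pt a b t)) ≤ ∑ v, dist v (σ v) := by
      rw [← Finset.sum_image (s := W) (g := T.pt a b) (f := fun v => dist v (σ v))]
      · exact Finset.sum_le_univ_sum_of_nonneg fun v => dist_nonneg
      · intro i hi j hj hij
        simp only [hW, coe_filter, mem_range, Set.mem_ofPred_eq] at hi hj
        exact T.pt_injOn hab hi.1.le hj.1.le hij
    rw [le_div_iff₀ hR]
    linarith
  have hcard : ((T.gaps σ a b).filter (T.IsFar a b R)).card ≤ W.card + 1 := by
    rw [← Finset.card_range (W.card + 1)]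
    -- An exit lies between any two far gaps and is far itself, so the number of exits up to `j`
    -- strictly increases along the far gaps.
    have hlt : ∀ j ∈ (T.gaps σ a b).filter (T.IsFar a b R),
        ∀ j' ∈ (T.gaps σ a b).filter (T.IsFar a b R), j < j' →
        (W.filter (· ≤ j)).card < (W.filter (· ≤ j')).card := by
      intro j hj j' hj' hlt
      rw [mem_filter] at hj hj'
      obtain ⟨t, hjt, htj', hout⟩ := T.exists_exit hσ hab hj.1 hj'.1 hlt
      refine Finset.card_lt_card ((Finset.ssubset_iff_of_subset ?_).2 ⟨t, ?_, ?_⟩)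
      · intro s hs
        rw [mem_filter] at hs ⊢
        exact ⟨hs.1, hs.2.trans hlt.le⟩
      · have hh := T.h_pos a b
        have hj'K : j' < T.K a b := by
          have := hj'.1
          simp only [gaps, mem_filter, mem_range] at this
          exact this.1
        simp only [hW, mem_filter, mem_range]
        have h1 : (j : ℝ) ≤ t := by exact_mod_cast hjt.le
        have h2 : (t : ℝ) ≤ j' := by exact_mod_cast htj'
        exact ⟨⟨by omega, ⟨hj.2.1.trans (by gcongr), hj'.2.2.trans (by gcongr)⟩, hout⟩, htj'⟩
      · rw [mem_filter]
        omega
    refine Finset.card_le_card_of_injOn (fun j => (W.filter (· ≤ j)).card) ?_ ?_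
    · intro j _
      simp only [coe_range, Set.mem_Iio, Nat.lt_succ_iff]
      exact Finset.card_filter_le _ _
    · intro j hj j' hj' h
      simp only at h
      rcases lt_trichotomy j j' with hc | hc | hc
      · exact absurd h (hlt j hj j' hj' hc).ne
      · exact hc
      · exact absurd h (hlt j' hj' j hj hc).ne'
  have hsplit : (T.gaps σ a b).card ≤ ((T.gaps σ a b).filter (T.IsFar a b R)).card +
      ((Finset.range (T.K a b)).filter fun j => ¬ T.IsFar a b R j).card := by
    rw [← Finset.card_filter_add_card_filter_not (s := T.gaps σ a b) (T.IsFar a b R)]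
    refine Nat.add_le_add_left (Finset.card_le_card ?_) _
    exact Finset.filter_subset_filter _ (Finset.filter_subset _ _)
  have hnear := T.h_mul_card_not_far_le a b hR
  have hh := T.h_pos a b
  have hh1 := T.h_le_one a b
  have h1 : ((T.gaps σ a b).card : ℝ) ≤ W.card + 1 +
      ((Finset.range (T.K a b)).filter fun j => ¬ T.IsFar a b R j).card := by
    exact_mod_cast hsplit.trans (Nat.add_le_add_right hcard _)
  have h2 : T.h a b * (W.card + 1) ≤ 1 * (W.card + 1) := by gcongr
  have h3 := mul_le_mul_of_nonneg_left h1 hh.le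
  rw [mul_add] at h3
  linarith

/-- The lower bound for the optimum tour. -/
lemma le_optTourLength {R : ℝ} (hR : 0 < R) :
    4 * ∑ a, T.r a ≤ optTourLength V + 48 * (2 * (R + 1) + 1 + 4 * optTourLength V / R) := by
  obtain ⟨σ, hlen, hσ⟩ := exists_perm_tour (V := V)
  have h := T.four_mul_sum_r_le σ
  have h2 : ∑ a, ∑ b ∈ Finset.univ.erase a, T.h a b * (T.gaps σ a b).card ≤
      ∑ a : Fin 4, ∑ b ∈ Finset.univ.erase a, (2 * (R + 1) + 1 + 4 * (∑ v, dist v (σ v)) / R) :=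
    Finset.sum_le_sum fun a _ => Finset.sum_le_sum fun b hb =>
      T.h_mul_card_gaps_le hσ (Finset.ne_of_mem_erase hb).symm hR
  -- There are 12 arms, one for each ordered pair of corners; with weight 4 this gives the factor
  -- 48.
  have h3 : ∀ C : ℝ, ∑ a : Fin 4, ∑ _b ∈ Finset.univ.erase a, C = 12 * C := by
    intro C
    simp only [Finset.sum_const, Finset.card_erase_of_mem (Finset.mem_univ _), Finset.card_univ,
      Fintype.card_fin, nsmul_eq_mul]
    norm_num
    ring
  rw [h3] at h2
  rw [hlen] at h h2
  linarith

end Far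

/-! ### Lower bound for the LP by moats -/

section Linear

lemma sum_pairs (f : Fin 4 × Fin 4 → ℝ) :
    ∑ p with p.1 < p.2, f p =
      f (0, 1) + f (0, 2) + f (0, 3) + f (1, 2) + f (1, 3) + f (2, 3) := by
  have : (Finset.univ.filter fun p : Fin 4 × Fin 4 => p.1 < p.2) =
      {(0, 1), (0, 2), (0, 3), (1, 2), (1, 3), (2, 3)} := by decide
  rw [this]
  repeat rw [Finset.sum_insert (by decide)]
  rw [Finset.sum_singleton]
  ring

/-- The moat radius is half the distance to the nearest other vertex. For a vertex at distance at
least 4 from both ends of its segment, other segments are at distance at least 1, so that distance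
is at least `h`. The excluded vertices cost at most `2 * (4 + 1)` on each of the six segments. -/
lemma le_subtourLPValue (hfeas : ∃ x : Sym2 V → ℝ, IsSubtourFeasible x) :
    3 * ∑ a, T.r a - 60 ≤ subtourLPValue V := by
  classical
  have hmain := TSP.le_subtourLPValue hfeas (fun v => Metric.infDist v {v}ᶜ / 2) (by
    intro u v huv
    have h1 : Metric.infDist u {u}ᶜ ≤ dist u v :=
      Metric.infDist_le_dist_of_mem (by simpa using huv.symm)
    have h2 : Metric.infDist v {v}ᶜ ≤ dist v u :=
      Metric.infDist_le_dist_of_mem (by simpa using huv)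
    rw [dist_comm] at h2
    linarith)
  rw [← Finset.sum_div, mul_div_cancel₀ _ (by norm_num)] at hmain
  refine le_trans ?_ hmain
  set S : Finset (Σ _ : Fin 4 × Fin 4, ℕ) :=
    (Finset.univ.filter fun p : Fin 4 × Fin 4 => p.1 < p.2).sigma fun p =>
      (Finset.range (T.K p.1 p.2)).filter (T.IsFar p.1 p.2 4) with hS
  have hSmem : ∀ q ∈ S, q.1.1 < q.1.2 ∧ q.2 < T.K q.1.1 q.1.2 ∧ T.IsFar q.1.1 q.1.2 4 q.2 := by
    intro q hq
    simpa [hS] using hq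
  have hinj : ∀ q ∈ S, ∀ q' ∈ S, T.pt q.1.1 q.1.2 q.2 = T.pt q'.1.1 q'.1.2 q'.2 → q = q' := by
    rintro ⟨⟨a, b⟩, i⟩ hq ⟨⟨c, d⟩, j⟩ hq' h
    obtain ⟨hab, hi, hf⟩ := hSmem _ hq
    obtain ⟨hcd, hj, -⟩ := hSmem _ hq'
    simp only at hab hcd hi hj hf h
    by_cases hne : s(a, b) = s(c, d)
    · rcases Sym2.eq_iff.1 hne with ⟨rfl, rfl⟩ | ⟨rfl, rfl⟩
      · rw [T.pt_injOn hab.ne hi.le hj.le h]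
      · exact absurd hab hcd.asymm
    · have := hf.div_four_le hab.ne hcd.ne hne hi.le hj.le
      rw [h, dist_self] at this
      norm_num at this
  have hge : ∀ q ∈ S, T.h q.1.1 q.1.2 ≤
      Metric.infDist (T.pt q.1.1 q.1.2 q.2) {T.pt q.1.1 q.1.2 q.2}ᶜ := by
    rintro ⟨⟨a, b⟩, i⟩ hq
    obtain ⟨hab, hi, hf⟩ := hSmem _ hq
    simp only at hab hi hf ⊢
    have hh := T.h_pos a b
    have hon : ∀ j, j ≤ T.K a b → T.pt a b j ≠ T.pt a b i → T.h a b ≤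
        dist (T.pt a b i) (T.pt a b j) := by
      intro j hj hne
      rw [T.dist_pt a b hab.ne i j hi.le hj]
      have hij : (i : ℤ) - j ≠ 0 := by
        intro h
        apply hne
        congr 1
        omega
      have : (1 : ℝ) ≤ |(i : ℝ) - j| := by exact_mod_cast Int.one_le_abs hij
      nlinarith
    refine (Metric.le_infDist ?_).2 ?_
    · refine ⟨T.corner a, fun h => ?_⟩
      rw [Set.mem_singleton_iff, ← T.pt_zero a b] at h
      have := T.pt_injOn hab.ne (Nat.zero_le _) hi.le h
      subst this
      have := hf.1
      norm_num at this
    · intro v hv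
      obtain ⟨c, d, hcd, j, hj, rfl⟩ := T.cover v
      have hv' : T.pt c d j ≠ T.pt a b i := hv
      by_cases hne : s(a, b) = s(c, d)
      · rcases Sym2.eq_iff.1 hne with ⟨rfl, rfl⟩ | ⟨rfl, rfl⟩
        · exact hon j hj hv'
        · rw [T.pt_rev a b j (T.K_symm a b ▸ hj)] at hv' ⊢
          exact hon _ (Nat.sub_le _ _) hv'
      · have := hf.div_four_le hab.ne hcd hne hi.le hj
        linarith [T.h_le_one a b]
  have hle : ∑ q ∈ S, T.h q.1.1 q.1.2 ≤ ∑ v : V, Metric.infDist v {v}ᶜ := by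
    refine (Finset.sum_le_sum hge).trans ?_
    rw [← Finset.sum_image (s := S) (g := fun q => T.pt q.1.1 q.1.2 q.2)
      (f := fun v : V => Metric.infDist v {v}ᶜ)]
    · exact Finset.sum_le_univ_sum_of_nonneg fun v => Metric.infDist_nonneg
    · exact fun q hq q' hq' h => hinj q hq q' hq' h
  refine le_trans ?_ hle
  rw [hS, Finset.sum_sigma]
  have hseg : ∀ p ∈ (Finset.univ.filter fun p : Fin 4 × Fin 4 => p.1 < p.2),
      T.r p.1 + T.r p.2 - 10 ≤
        ∑ _j ∈ (Finset.range (T.K p.1 p.2)).filter (T.IsFar p.1 p.2 4), T.h p.1 p.2 := by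
    intro p hp
    rw [mem_filter] at hp
    rw [T.r_add _ _ hp.2.ne, Finset.sum_const, nsmul_eq_mul]
    have h1 := T.h_mul_card_not_far_le p.1 p.2 (R := 4) (by norm_num)
    have h2 := Finset.card_filter_add_card_filter_not (s := Finset.range (T.K p.1 p.2))
      (T.IsFar p.1 p.2 4)
    rw [Finset.card_range] at h2
    have h3 : (T.K p.1 p.2 : ℝ) = ((Finset.range (T.K p.1 p.2)).filter (T.IsFar p.1 p.2 4)).card +
      ((Finset.range (T.K p.1 p.2)).filter fun j => ¬ T.IsFar p.1 p.2 4 j).card := by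
      exact_mod_cast h2.symm
    rw [h3]
    linarith
  refine le_trans (le_of_eq ?_) (Finset.sum_le_sum hseg)
  -- Every corner belongs to three segments.
  rw [sum_pairs, Fin.sum_univ_four]
  ring

end Linear

end Network

open Classical in
/-- Shortcutting a closed walk to a cycle through prescribed vertices. -/
lemma exists_isCycle_le_walkLength {V : Type*} [Fintype V] [MetricSpace V] {z : V} {L L' : List V}
    (hsub : L'.Sublist (L ++ [z])) {u v : V} (huv : u ≠ v) (hu : u ∈ L') (hv : v ∈ L') :
    ∃ σ : Equiv.Perm V, σ.IsCycle ∧ (∀ w, w ∈ σ.support ↔ w ∈ L') ∧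
      ∑ w, dist w (σ w) ≤ walkLength z (L ++ [z]) := by
  have hu' := List.mem_dedup.2 hu
  have hv' := List.mem_dedup.2 hv
  have hnd := List.nodup_dedup L'
  have hs : L'.dedup.Sublist (L ++ [z]) := (List.dedup_sublist _).trans hsub
  have hmem : ∀ w, w ∈ L'.dedup ↔ w ∈ L' := fun w => List.mem_dedup
  generalize L'.dedup = D at hu' hv' hnd hs hmem
  obtain _ | ⟨x, _ | ⟨y, l⟩⟩ := D
  · simp at hu'
  · rw [List.mem_singleton] at hu' hv'
    exact absurd (hu'.trans hv'.symm) huv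
  · refine ⟨(x :: y :: l).formPerm, List.isCycle_formPerm hnd (by simp), fun w => ?_, ?_⟩
    · rw [List.support_formPerm_of_nodup _ hnd (by simp), List.mem_toFinset, hmem]
    · rw [sum_dist_formPerm x _ hnd]
      exact closed_walkLength_sublist_le hs

/-! ### Explicit routes: upper bounds for the tour and the LP -/

namespace Network

variable {V : Type*} [Fintype V] [MetricSpace V] (T : Network V)

/-- The vertices on the segment from `a` to `b`, without the first one. -/
def seg (a b : Fin 4) : List V := (List.range' 1 (T.K a b)).map (T.pt a b)

lemma walkLength_seg_append {a b : Fin 4} (hab : a ≠ b) (l : List V) :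
    walkLength (T.corner a) (T.seg a b ++ l) = T.r a + T.r b + walkLength (T.corner b) l := by
  have key : ∀ k i, i + k ≤ T.K a b →
      walkLength (T.pt a b i) ((List.range' (i + 1) k).map (T.pt a b) ++ l) =
        k * T.h a b + walkLength (T.pt a b (i + k)) l := by
    intro k
    induction k with
    | zero => intro i _; simp
    | succ k ih =>
      intro i hi
      rw [List.range'_succ, List.map_cons, List.cons_append, walkLength, ih (i + 1) (by omega),
        T.dist_pt a b hab i (i + 1) (by omega) (by omega), show i + 1 + k = i + (k + 1) by ring]
      push_cast
      rw [show (i : ℝ) - (i + 1) = -1 by ring, abs_neg, abs_one]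
      ring
  have h := key (T.K a b) 0 (by omega)
  rw [T.pt_zero, Nat.zero_add, Nat.zero_add, T.pt_K, ← T.r_add a b hab] at h
  exact h

lemma mem_seg {a b : Fin 4} {v : V} :
    v ∈ T.seg a b ↔ ∃ j, 1 ≤ j ∧ j ≤ T.K a b ∧ v = T.pt a b j := by
  simp only [seg, List.mem_map, List.mem_range'_1]
  constructor
  · rintro ⟨j, hj, rfl⟩
    exact ⟨j, by omega, by omega, rfl⟩
  · rintro ⟨j, h1, h2, rfl⟩
    exact ⟨j, by omega, rfl⟩

lemma corner_mem_seg (a b : Fin 4) : T.corner b ∈ T.seg a b :=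
  T.mem_seg.2 ⟨T.K a b, by linarith [T.two_le_K a b], le_rfl, (T.pt_K a b).symm⟩

/-- The vertex `v` lies on the closed segment from `a` to `b`. -/
def OnSeg (a b : Fin 4) (v : V) : Prop := ∃ j, j ≤ T.K a b ∧ v = T.pt a b j

lemma onSeg_comm {a b : Fin 4} {v : V} : T.OnSeg a b v ↔ T.OnSeg b a v := by
  have : ∀ a b, T.OnSeg a b v → T.OnSeg b a v := by
    rintro a b ⟨j, hj, rfl⟩
    refine ⟨T.K b a - j, Nat.sub_le _ _, ?_⟩
    rw [← T.pt_rev b a j (T.K_symm a b ▸ hj)]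
  exact ⟨this a b, this b a⟩

lemma onSeg_congr {a b c d : Fin 4} (h : s(a, b) = s(c, d)) {v : V} :
    T.OnSeg a b v ↔ T.OnSeg c d v := by
  rcases Sym2.eq_iff.1 h with ⟨rfl, rfl⟩ | ⟨rfl, rfl⟩
  · rfl
  · exact T.onSeg_comm

lemma pair_cases : ∀ a b : Fin 4, a ≠ b → s(a, b) = s(0, 1) ∨ s(a, b) = s(1, 2) ∨
    s(a, b) = s(2, 3) ∨ s(a, b) = s(2, 0) ∨ s(a, b) = s(0, 3) ∨ s(a, b) = s(3, 1) := by
  decide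

lemma onSeg_iff {a b : Fin 4} {v : V} : T.OnSeg a b v ↔ v ∈ T.seg a b ∨ v = T.corner a := by
  rw [mem_seg]
  constructor
  · rintro ⟨j, hj, rfl⟩
    rcases Nat.eq_zero_or_pos j with rfl | h
    · exact Or.inr (T.pt_zero a b)
    · exact Or.inl ⟨j, h, hj, rfl⟩
  · rintro (⟨j, -, hj, rfl⟩ | rfl)
    · exact ⟨j, hj, rfl⟩
    · exact ⟨0, Nat.zero_le _, (T.pt_zero a b).symm⟩

lemma exists_seg_eq_append (a b : Fin 4) : ∃ M, T.seg a b = M ++ [T.corner b] := by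
  have h2 := T.two_le_K a b
  refine ⟨(List.range' 1 (T.K a b - 1)).map (T.pt a b), ?_⟩
  have : List.range' 1 (T.K a b) = List.range' 1 (T.K a b - 1) ++ [T.K a b] := by
    conv_lhs => rw [show T.K a b = (T.K a b - 1) + 1 by omega]
    rw [List.range'_concat]
    congr 2
    omega
  rw [seg, this, List.map_append, List.map_singleton, T.pt_K]

/-- The walk that starts in corner `a` and visits the given corners along the segments. -/
def route : Fin 4 → List (Fin 4) → List V
  | _, [] => []
  | a, b :: l => T.seg a b ++ route b l

lemma exists_route_eq_append (a b : Fin 4) (l : List (Fin 4)) :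
    ∃ M, T.route a (l ++ [b]) = M ++ [T.corner b] := by
  induction l generalizing a with
  | nil => simpa [route] using T.exists_seg_eq_append a b
  | cons c l ih =>
    obtain ⟨M, hM⟩ := ih c
    exact ⟨T.seg a c ++ M, by rw [List.cons_append, route, hM, List.append_assoc]⟩

/-- Doubling the perfect matching of the segments `01` and `23` makes all degrees even. The
resulting Eulerian walk passes each corner twice, so each radius is counted four times. -/
lemma optTourLength_le_four_mul : optTourLength V ≤ 4 * ∑ a, T.r a := by
  obtain ⟨M, hM⟩ := T.exists_route_eq_append 0 0 [1, 2, 3, 2, 0, 3, 1]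
  have hlen : walkLength (T.corner 0) (T.route 0 ([1, 2, 3, 2, 0, 3, 1] ++ [0])) =
      4 * ∑ a, T.r a := by
    simp only [List.cons_append, List.nil_append, route]
    repeat rw [T.walkLength_seg_append (by decide)]
    rw [walkLength, Fin.sum_univ_four]
    ring
  have hmem : ∀ v, v ∈ T.route 0 ([1, 2, 3, 2, 0, 3, 1] ++ [0]) := by
    intro v
    simp only [List.cons_append, List.nil_append, route, List.mem_append]
    obtain ⟨a, b, hab, hv⟩ := T.cover v
    have key : ∀ c d, s(a, b) = s(c, d) → v ∈ T.seg c d ∨ v = T.corner c := fun c d h =>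
      T.onSeg_iff.1 ((T.onSeg_congr h).1 hv)
    rcases pair_cases a b hab with h | h | h | h | h | h <;> rcases key _ _ h with h' | h' <;>
      simp only [h', corner_mem_seg, true_or, or_true]
  rw [← hlen]
  rw [hM] at hmem ⊢
  exact optTourLength_le_walkLength hmem

/-- The vertex `v` is one of the four corners. -/
def IsCorner (v : V) : Prop := ∃ a, v = T.corner a

lemma onSeg_of_not_isCorner {a b c d : Fin 4} (hab : a ≠ b) (hcd : c ≠ d) {v : V}
    (hv : ¬ T.IsCorner v) (h1 : T.OnSeg a b v) (h2 : T.OnSeg c d v) : s(a, b) = s(c, d) := by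
  by_contra hne
  obtain ⟨i, hi, rfl⟩ := h1
  obtain ⟨j, hj, h⟩ := h2
  rcases T.eq_end_of_pt_eq hab hcd hne hi hj h with h0 | h0
  · exact hv ⟨a, h0 ▸ T.pt_zero a b⟩
  · exact hv ⟨b, h0 ▸ T.pt_K a b⟩

lemma not_isCorner_pt_one {a b : Fin 4} (hab : a ≠ b) : ¬ T.IsCorner (T.pt a b 1) := by
  have h2 := T.two_le_K a b
  rintro ⟨c, hc⟩
  rcases T.corner_eq_pt hab (by omega) hc.symm with rfl | rfl
  · rw [← T.pt_zero c b] at hc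
    exact absurd (T.pt_injOn hab (by omega) (by omega) hc) (by omega)
  · rw [← T.pt_K a c] at hc
    exact absurd (T.pt_injOn hab (by omega) (by omega) hc) (by omega)

lemma three_le_card (T : Network V) : 3 ≤ Fintype.card V :=
  le_trans (by simp) (Fintype.card_le_of_injective _ T.corner_injective)

/-- The closed walk through the corners `a, b, c, d`. -/
lemma mem_route_four {a b c d : Fin 4} {v : V} :
    v ∈ T.route a ([b, c, d] ++ [a]) ↔
      T.OnSeg a b v ∨ T.OnSeg b c v ∨ T.OnSeg c d v ∨ T.OnSeg d a v := by
  simp only [List.cons_append, List.nil_append, route, List.mem_append, onSeg_iff]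
  have hc : ∀ c, v = T.corner c → ∀ d, v ∈ T.seg d c := by
    rintro c rfl d
    exact T.corner_mem_seg d c
  have h0 := fun h => hc a h d
  have h1 := fun h => hc b h a
  have h2 := fun h => hc c h b
  have h3 := fun h => hc d h c
  clear hc
  have hn : v ∉ ([] : List V) := List.not_mem_nil
  tauto

open Classical in
-- The three Hamiltonian cycles on the corners have length `2 * ∑ a, T.r a` each, and every inner
-- vertex of a segment lies on two of them. Corners lie on all three, so `σ₀` shortcuts past them.
lemma exists_feasible_le : ∃ x : Sym2 V → ℝ, IsSubtourFeasible x ∧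
    ∑ e ∈ edges V, edgeCost e * x e ≤ 3 * ∑ a, T.r a := by
  have hlen : ∀ a b c d : Fin 4, a ≠ b → b ≠ c → c ≠ d → d ≠ a →
      walkLength (T.corner a) (T.route a ([b, c, d] ++ [a])) =
        2 * (T.r a + T.r b + T.r c + T.r d) := by
    intro a b c d h1 h2 h3 h4
    simp only [List.cons_append, List.nil_append, route]
    rw [T.walkLength_seg_append h1, T.walkLength_seg_append h2, T.walkLength_seg_append h3,
      T.walkLength_seg_append h4, walkLength]
    ring
  have hcyc : ∀ a b c d : Fin 4, a ≠ b → b ≠ c → c ≠ d → d ≠ a → ∀ (P : V → Prop) (u v : V),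
      u ≠ v → P u → P v → u ∈ T.route a ([b, c, d] ++ [a]) → v ∈ T.route a ([b, c, d] ++ [a]) →
      ∃ σ : Equiv.Perm V, σ.IsCycle ∧ (∀ w, w ∈ σ.support ↔ P w ∧
        (T.OnSeg a b w ∨ T.OnSeg b c w ∨ T.OnSeg c d w ∨ T.OnSeg d a w)) ∧
        ∑ w, dist w (σ w) ≤ 2 * (T.r a + T.r b + T.r c + T.r d) := by
    intro a b c d h1 h2 h3 h4 P u v huv hPu hPv hu hv
    obtain ⟨M, hM⟩ := T.exists_route_eq_append a a [b, c, d]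
    have hsub : ((T.route a ([b, c, d] ++ [a])).filter P).Sublist (M ++ [T.corner a]) :=
      hM ▸ List.filter_sublist
    obtain ⟨σ, hσ, hs, hle⟩ := exists_isCycle_le_walkLength hsub huv
      (List.mem_filter.2 ⟨hu, by simpa using hPu⟩) (List.mem_filter.2 ⟨hv, by simpa using hPv⟩)
    refine ⟨σ, hσ, fun w => ?_, ?_⟩
    · rw [hs, List.mem_filter, mem_route_four, decide_eq_true_iff, and_comm]
    · rwa [← hM, hlen a b c d h1 h2 h3 h4] at hle
  have hK := T.two_le_K
  have on1 : ∀ a b, T.OnSeg a b (T.pt a b 1) := fun a b => ⟨1, by linarith [hK a b], rfl⟩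
  have onc : ∀ a b, T.OnSeg a b (T.corner a) := fun a b => T.onSeg_iff.2 (Or.inr rfl)
  have hnc01 := T.not_isCorner_pt_one (show (0 : Fin 4) ≠ 1 by decide)
  have hnc12 := T.not_isCorner_pt_one (show (1 : Fin 4) ≠ 2 by decide)
  have hne : T.pt 0 1 1 ≠ T.pt 1 2 1 := by
    intro h
    have := T.onSeg_of_not_isCorner (by decide) (by decide) hnc01 (on1 0 1) (h ▸ on1 1 2)
    exact absurd this (by decide)
  have hcne : T.corner 0 ≠ T.corner 1 := T.corner_injective.ne (by decide)
  obtain ⟨σ₀, hσ₀, hs₀, hl₀⟩ := hcyc 0 1 2 3 (by decide) (by decide) (by decide) (by decide)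
    (fun v => ¬ T.IsCorner v) _ _ hne hnc01 hnc12
    (T.mem_route_four.2 (Or.inl (on1 _ _))) (T.mem_route_four.2 (Or.inr (Or.inl (on1 _ _))))
  obtain ⟨σ₁, hσ₁, hs₁, hl₁⟩ := hcyc 0 1 3 2 (by decide) (by decide) (by decide) (by decide)
    (fun _ => True) _ _ hcne trivial trivial
    (T.mem_route_four.2 (Or.inl (onc _ _))) (T.mem_route_four.2 (Or.inr (Or.inl (onc _ _))))
  obtain ⟨σ₂, hσ₂, hs₂, hl₂⟩ := hcyc 0 2 1 3 (by decide) (by decide) (by decide) (by decide)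
    (fun _ => True) _ _ hcne trivial trivial
    (T.mem_route_four.2 (Or.inl (onc _ _)))
    (T.mem_route_four.2 (Or.inr (Or.inr (Or.inl (onc _ _)))))
  set σ : Fin 3 → Equiv.Perm V := ![σ₀, σ₁, σ₂] with hσdef
  have hs : ∀ v, (Finset.univ.filter fun k => v ∈ (σ k).support).card =
      (if v ∈ σ₀.support then 1 else 0) + (if v ∈ σ₁.support then 1 else 0) +
        if v ∈ σ₂.support then 1 else 0 := by
    intro v
    rw [Finset.card_filter, Fin.sum_univ_three]
    rfl
  refine ⟨_, isSubtourFeasible_three_cycles T.three_le_card σ ?_ ?_ ?_, ?_⟩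
  · intro k
    fin_cases k <;> assumption
  · intro v
    rw [hs]
    by_cases hv : T.IsCorner v
    · have h0 : v ∉ σ₀.support := fun h => ((hs₀ v).1 h).1 hv
      have h1 : v ∈ σ₁.support := by
        rw [hs₁]
        obtain ⟨a, rfl⟩ := hv
        refine ⟨trivial, ?_⟩
        fin_cases a
        · exact Or.inl (onc _ _)
        · exact Or.inr (Or.inl (onc _ _))
        · exact Or.inr (Or.inr (Or.inr (onc _ _)))
        · exact Or.inr (Or.inr (Or.inl (onc _ _)))
      have h2 : v ∈ σ₂.support := by
        rw [hs₂]
        obtain ⟨a, rfl⟩ := hv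
        refine ⟨trivial, ?_⟩
        fin_cases a
        · exact Or.inl (onc _ _)
        · exact Or.inr (Or.inr (Or.inl (onc _ _)))
        · exact Or.inr (Or.inl (onc _ _))
        · exact Or.inr (Or.inr (Or.inr (onc _ _)))
      simp [h0, h1, h2]
    · obtain ⟨a, b, hab, hon⟩ := T.cover v
      change T.OnSeg a b v at hon
      have hon' : ∀ c d, c ≠ d → (T.OnSeg c d v ↔ s(a, b) = s(c, d)) := by
        intro c d hcd
        refine ⟨T.onSeg_of_not_isCorner hab hcd hv hon, fun h => ?_⟩
        exact (T.onSeg_congr h).1 hon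
      simp only [hs₀, hs₁, hs₂, hv, not_false_eq_true, true_and]
      rw [hon' 0 1 (by decide), hon' 1 2 (by decide), hon' 2 3 (by decide), hon' 3 0 (by decide),
        hon' 1 3 (by decide), hon' 3 2 (by decide), hon' 2 0 (by decide), hon' 0 2 (by decide),
        hon' 2 1 (by decide)]
      clear hon hon'
      rcases pair_cases a b hab with h | h | h | h | h | h <;> rw [h] <;> simp
  -- Since `σ₀` has no corners, it meets the other cycles in inner vertices of the segments `01` and
  -- `12`.
  · have h01 : ∀ a b v, v = T.pt 0 1 1 → (a = σ₀ ∨ a = σ₁) → (b = σ₀ ∨ b = σ₁) →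
        v ∈ a.support ∧ v ∈ b.support := by
      rintro a b v rfl (rfl | rfl) (rfl | rfl) <;> simp [hs₀, hs₁, hnc01, on1]
    have h12 : ∀ a b v, v = T.pt 1 2 1 → (a = σ₀ ∨ a = σ₂) → (b = σ₀ ∨ b = σ₂) →
        v ∈ a.support ∧ v ∈ b.support := by
      have := T.onSeg_comm.1 (on1 1 2)
      rintro a b v rfl (rfl | rfl) (rfl | rfl) <;> simp [hs₀, hs₂, hnc12, on1, this]
    have hc : ∀ a b v, v = T.corner 0 → (a = σ₁ ∨ a = σ₂) → (b = σ₁ ∨ b = σ₂) →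
        v ∈ a.support ∧ v ∈ b.support := by
      rintro a b v rfl (rfl | rfl) (rfl | rfl) <;> simp [hs₁, hs₂, onc]
    have hk : ∀ k, σ k = σ₀ ∨ σ k = σ₁ ∨ σ k = σ₂ := by
      intro k
      fin_cases k <;> simp [hσdef]
    intro k l
    rcases hk k with h | h | h <;> rcases hk l with h' | h' | h' <;> rw [h, h']
    · exact ⟨_, h01 _ _ _ rfl (Or.inl rfl) (Or.inl rfl)⟩
    · exact ⟨_, h01 _ _ _ rfl (Or.inl rfl) (Or.inr rfl)⟩
    · exact ⟨_, h12 _ _ _ rfl (Or.inl rfl) (Or.inr rfl)⟩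
    · exact ⟨_, h01 _ _ _ rfl (Or.inr rfl) (Or.inl rfl)⟩
    · exact ⟨_, hc _ _ _ rfl (Or.inl rfl) (Or.inl rfl)⟩
    · exact ⟨_, hc _ _ _ rfl (Or.inl rfl) (Or.inr rfl)⟩
    · exact ⟨_, h12 _ _ _ rfl (Or.inr rfl) (Or.inl rfl)⟩
    · exact ⟨_, hc _ _ _ rfl (Or.inr rfl) (Or.inl rfl)⟩
    · exact ⟨_, hc _ _ _ rfl (Or.inr rfl) (Or.inr rfl)⟩
  · rw [sum_cost_three_cycles, Fin.sum_univ_three, Fin.sum_univ_four]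
    change (∑ u, dist u (σ₀ u) + ∑ u, dist u (σ₁ u) + ∑ u, dist u (σ₂ u)) / 2 ≤ _
    linarith

lemma subtourLPValue_le_three_mul : subtourLPValue V ≤ 3 * ∑ a, T.r a := by
  obtain ⟨x, hx, hle⟩ := T.exists_feasible_le
  exact (subtourLPValue_le hx).trans hle

lemma three_mul_sub_le_subtourLPValue : 3 * ∑ a, T.r a - 60 ≤ subtourLPValue V := by
  obtain ⟨x, hx, -⟩ := T.exists_feasible_le
  exact T.le_subtourLPValue ⟨x, hx⟩

end Network

/-! ### Distances between the segments in the plane -/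

section Geometry

variable (n m : ℕ)

/-- The corners and the center of the equilateral triangle with side length `n`. -/
noncomputable def apex : Fin 4 → Plane :=
  ![!₂[0, 0], !₂[(n : ℝ), 0], !₂[(n : ℝ) / 2, n * √3 / 2], !₂[(n : ℝ) / 2, n * √3 / 6]]

/-- The distance of two apexes. -/
noncomputable def sideLength (a b : Fin 4) : ℝ := if a = 3 ∨ b = 3 then n * √3 / 3 else n

/-- The number of parts of a segment. -/
def sideParts (a b : Fin 4) : ℕ := if a = 3 ∨ b = 3 then m else n

lemma inner_apex_sub (a b c d : Fin 4) :
    inner ℝ (apex n b - apex n a) (apex n d - apex n c) =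
      (apex n b 0 - apex n a 0) * (apex n d 0 - apex n c 0) +
      (apex n b 1 - apex n a 1) * (apex n d 1 - apex n c 1) := by
  simp [PiLp.inner_apply, Fin.sum_univ_two, mul_comm]

lemma sqrt_three_sq : √3 * √3 = (3 : ℝ) := Real.mul_self_sqrt (by norm_num)

lemma sideLength_nonneg (a b : Fin 4) : 0 ≤ sideLength n a b := by
  unfold sideLength
  split_ifs <;> positivity

lemma norm_apex_sub {a b : Fin 4} (hab : a ≠ b) :
    ‖apex n b - apex n a‖ = sideLength n a b := by
  have h3 := sqrt_three_sq
  rw [← sq_eq_sq₀ (norm_nonneg _) (sideLength_nonneg n a b), ← real_inner_self_eq_norm_sq,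
    inner_apex_sub]
  fin_cases a <;> fin_cases b <;> first
    | exact absurd rfl hab
    | (simp [apex, sideLength]; ring_nf <;> norm_num <;> ring)

/-- The angles at a common end are 30, 60 or 120 degrees, and `√3 / 2` is the cosine of the
smallest. -/
lemma inner_apex_le {a b c : Fin 4} (hab : a ≠ b) (hac : a ≠ c) (hbc : b ≠ c) :
    inner ℝ (apex n b - apex n a) (apex n c - apex n a) ≤
      √3 / 2 * (sideLength n a b * sideLength n a c) := by
  have h3 := sqrt_three_sq
  have h1 : (1 : ℝ) ≤ √3 := by rw [Real.one_le_sqrt]; norm_num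
  have hn : (0 : ℝ) ≤ n := by positivity
  rw [inner_apex_sub]
  fin_cases a <;> fin_cases b <;> fin_cases c <;> first
    | exact absurd rfl hab
    | exact absurd rfl hac
    | exact absurd rfl hbc
    | (simp [apex, sideLength]; nlinarith [mul_nonneg hn hn,
        mul_le_mul_of_nonneg_left h1 (mul_nonneg hn hn)])

lemma inner_apex_opposite {a b c : Fin 4} (ha : a ≠ 3) (hb : b ≠ 3) (hc : c ≠ 3) (hab : a ≠ b)
    (hac : a ≠ c) (hbc : b ≠ c) :
    inner ℝ (apex n c - apex n 3) (apex n b - apex n a) = 0 ∧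
      inner ℝ (apex n c - apex n 3) (apex n 3 - apex n a) = (n : ℝ) ^ 2 / 6 := by
  have h3 := sqrt_three_sq
  rw [inner_apex_sub, inner_apex_sub]
  fin_cases a <;> fin_cases b <;> fin_cases c <;> first
    | exact absurd rfl ha
    | exact absurd rfl hb
    | exact absurd rfl hc
    | exact absurd rfl hab
    | exact absurd rfl hac
    | exact absurd rfl hbc
    | (constructor <;> simp [apex] <;> nlinarith)

/-- The points of the line through two apexes. -/
noncomputable def onLine (a b : Fin 4) (t : ℝ) : Plane :=
  apex n a + t • (apex n b - apex n a)

lemma onLine_symm (a b : Fin 4) (t : ℝ) : onLine n a b t = onLine n b a (1 - t) := by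
  unfold onLine
  module

lemma dist_onLine {a b : Fin 4} (hab : a ≠ b) (s t : ℝ) :
    dist (onLine n a b s) (onLine n a b t) = |s - t| * sideLength n a b := by
  rw [dist_eq_norm, ← norm_apex_sub n hab, ← Real.norm_eq_abs, ← norm_smul]
  congr 1
  unfold onLine
  module

lemma sideLength_symm (a b : Fin 4) : sideLength n a b = sideLength n b a := by
  simp only [sideLength, or_comm]

/-- The factor is the sine of 30 degrees; completing the square in the law of cosines plays the role
of dropping the perpendicular. -/
lemma half_le_dist_onLine {a b c : Fin 4} (hab : a ≠ b) (hac : a ≠ c) (hbc : b ≠ c) {s t : ℝ}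
    (hs : 0 ≤ s) (ht : 0 ≤ t) :
    s * sideLength n a b / 2 ≤ dist (onLine n a b s) (onLine n a c t) := by
  have hin := inner_apex_le n hab hac hbc
  have h3 := sqrt_three_sq
  have hb := norm_apex_sub n hab
  have hc := norm_apex_sub n hac
  have hd : onLine n a b s - onLine n a c t =
      s • (apex n b - apex n a) - t • (apex n c - apex n a) := by
    unfold onLine
    module
  rw [dist_eq_norm, hd]
  have hx := sideLength_nonneg n a b
  have hy := sideLength_nonneg n a c
  generalize sideLength n a b = x at *
  generalize sideLength n a c = y at *
  refine (sq_le_sq₀ (by positivity) (norm_nonneg _)).1 ?_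
  rw [norm_sub_sq_real, norm_smul, norm_smul, real_inner_smul_left, real_inner_smul_right, hb, hc,
    Real.norm_of_nonneg hs, Real.norm_of_nonneg ht]
  have h1 := mul_le_mul_of_nonneg_left hin (mul_nonneg hs ht)
  have h2 : (t * y - √3 / 2 * (s * x)) ^ 2 =
      (t * y) ^ 2 - √3 * (s * x) * (t * y) + 3 / 4 * (s * x) ^ 2 := by
    linear_combination (s * x) ^ 2 / 4 * h3
  nlinarith [sq_nonneg (t * y - √3 / 2 * (s * x))]

/-- The direction from the center to `c` is perpendicular to the side `ab`. By Cauchy–Schwarz the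
distance is at least the inradius, which exceeds `n / 8`. -/
lemma div_eight_le_dist_onLine_center {a b c : Fin 4} (ha : a ≠ 3) (hb : b ≠ 3) (hc : c ≠ 3)
    (hab : a ≠ b) (hac : a ≠ c) (hbc : b ≠ c) {s t : ℝ} (ht : 0 ≤ t) :
    (n : ℝ) / 8 ≤ dist (onLine n a b s) (onLine n 3 c t) := by
  obtain ⟨h0, h1⟩ := inner_apex_opposite n ha hb hc hab hac hbc
  have hw : ‖apex n c - apex n 3‖ = n * √3 / 3 := by
    rw [norm_apex_sub n hc.symm]
    simp [sideLength]
  have h3 := sqrt_three_sq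
  have hd : onLine n 3 c t - onLine n a b s = (apex n 3 - apex n a) +
      t • (apex n c - apex n 3) - s • (apex n b - apex n a) := by
    unfold onLine
    module
  have hcs := real_inner_le_norm (apex n c - apex n 3) (onLine n 3 c t - onLine n a b s)
  rw [hd, inner_sub_right, inner_add_right, real_inner_smul_right, real_inner_smul_right, h0, h1,
    real_inner_self_eq_norm_sq, hw, ← hd, ← dist_eq_norm, dist_comm] at hcs
  have hlt : √3 < 4 := by rw [Real.sqrt_lt' (by norm_num)]; norm_num
  have hpos : 0 ≤ t * (n * √3 / 3 : ℝ) ^ 2 := by positivity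
  rcases Nat.eq_zero_or_pos n with rfl | hn
  · simp
  have hn' : (0 : ℝ) < n := by exact_mod_cast hn
  by_contra! hlt'
  have hk : (n : ℝ) * √3 / 3 * dist (onLine n a b s) (onLine n 3 c t) ≤ n * √3 / 3 * (n / 8) := by
    gcongr
  nlinarith [mul_pos hn' hn']

lemma div_eight_le_dist_onLine {a b c d : Fin 4} (hab : a ≠ b) (hac : a ≠ c) (had : a ≠ d)
    (hbc : b ≠ c) (hbd : b ≠ d) (hcd : c ≠ d) {s t : ℝ} (hs : 0 ≤ s) (hs1 : s ≤ 1) (ht : 0 ≤ t)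
    (ht1 : t ≤ 1) :
    (n : ℝ) / 8 ≤ dist (onLine n a b s) (onLine n c d t) := by
  have hs' : 0 ≤ 1 - s := by linarith
  have ht' : 0 ≤ 1 - t := by linarith
  have h3 : a = 3 ∨ b = 3 ∨ c = 3 ∨ d = 3 := by
    revert a b c d
    decide
  rcases h3 with rfl | rfl | rfl | rfl
  · rw [dist_comm]
    exact div_eight_le_dist_onLine_center n hac.symm had.symm hab.symm hcd hbc.symm hbd.symm hs
  · rw [dist_comm, onLine_symm n a 3]
    exact div_eight_le_dist_onLine_center n hbc.symm hbd.symm hab hcd hac.symm had.symm hs'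
  · exact div_eight_le_dist_onLine_center n hac hbc hcd.symm hab had hbd ht
  · rw [onLine_symm n c 3]
    exact div_eight_le_dist_onLine_center n had hbd hcd hab hac hbc ht'

lemma sideLength_le (a b : Fin 4) : sideLength n a b ≤ n := by
  have hlt : √3 < 3 := by rw [Real.sqrt_lt' (by norm_num)]; norm_num
  have hn : (0 : ℝ) ≤ n := by positivity
  unfold sideLength
  split_ifs
  · nlinarith
  · exact le_rfl

lemma div_four_le_dist_onLine {a b c d : Fin 4} (hab : a ≠ b) (hcd : c ≠ d)
    (hne : s(a, b) ≠ s(c, d)) {s t : ℝ} (hs : 0 ≤ s) (hs1 : s ≤ 1) (ht : 0 ≤ t)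
    (ht1 : t ≤ 1) {R : ℝ} (h1 : R ≤ s * sideLength n a b) (h2 : R ≤ (1 - s) * sideLength n a b) :
    R / 4 ≤ dist (onLine n a b s) (onLine n c d t) := by
  have hs' : 0 ≤ 1 - s := by linarith
  have ht' : 0 ≤ 1 - t := by linarith
  have hlen := sideLength_nonneg n a b
  have hlen' := sideLength_le n a b
  have hp1 := mul_nonneg hs hlen
  have hp2 := mul_nonneg hs' hlen
  by_cases hac : a = c
  · subst hac
    have hbd : b ≠ d := fun h => hne (h ▸ rfl)
    linarith [half_le_dist_onLine n hab hcd hbd hs ht]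
  by_cases had : a = d
  · subst had
    have hbc : b ≠ c := fun h => hne (h ▸ Sym2.eq_swap)
    rw [onLine_symm n c a]
    linarith [half_le_dist_onLine n hab hcd.symm hbc hs ht']
  by_cases hbc : b = c
  · subst hbc
    rw [onLine_symm n a b]
    have := half_le_dist_onLine n hab.symm hcd had hs' ht
    rw [sideLength_symm n b a] at this
    linarith
  by_cases hbd : b = d
  · subst hbd
    rw [onLine_symm n a b, onLine_symm n c b]
    have := half_le_dist_onLine n hab.symm hcd.symm hac hs' ht'
    rw [sideLength_symm n b a] at this
    linarith
  -- The two bounds on `R` add up to `2 * R ≤ n`, so `R / 4 ≤ n / 8`.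
  have := div_eight_le_dist_onLine n hab hac had hbc hbd hcd hs hs1 ht ht1
  linarith

end Geometry

/-! ### The given coordinates as points on the segments -/

section Tetrahedron

variable {n m : ℕ}

lemma sideParts_symm (a b : Fin 4) : sideParts n m a b = sideParts n m b a := by
  simp only [sideParts, or_comm]

lemma ptA_eq (hn : n ≠ 0) (i : ℕ) : ptA n i = onLine n 1 2 (i / n) := by
  have hn' : (n : ℝ) ≠ 0 := by exact_mod_cast hn
  ext k
  fin_cases k <;> simp [ptA, onLine, apex] <;> field_simp <;> ring

lemma ptB_eq (hn : n ≠ 0) (i : ℕ) : ptB n i = onLine n 2 0 (i / n) := by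
  have hn' : (n : ℝ) ≠ 0 := by exact_mod_cast hn
  ext k
  fin_cases k <;> simp [ptB, onLine, apex] <;> field_simp <;> ring

lemma ptC_eq (hn : n ≠ 0) (i : ℕ) : ptC i = onLine n 0 1 (i / n) := by
  have hn' : (n : ℝ) ≠ 0 := by exact_mod_cast hn
  ext k
  fin_cases k <;> simp [ptC, onLine, apex] <;> field_simp

lemma div_mul_sqrt_three (x y : ℝ) : x / (y * √3) = x * √3 / (3 * y) := by
  have h3 : √3 ≠ 0 := by positivity
  by_cases hy : y = 0
  · simp [hy]
  · rw [div_eq_div_iff (mul_ne_zero hy h3) (mul_ne_zero (by norm_num) hy)]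
    linear_combination -(x * y) * sqrt_three_sq

lemma ptE_eq (hm : m ≠ 0) (j : ℕ) : ptE n m j = onLine n 0 3 (j / m) := by
  have hm' : (m : ℝ) ≠ 0 := by exact_mod_cast hm
  ext k
  fin_cases k
  · simp [ptE, onLine, apex]
    field_simp
  · simp only [ptE, onLine, apex]
    simp
    rw [show 2 * √3 * (m : ℝ) = 2 * m * √3 by ring, div_mul_sqrt_three]
    field_simp
    ring

lemma ptF_eq (hm : m ≠ 0) (j : ℕ) : ptF n m j = onLine n 1 3 (j / m) := by
  have hm' : (m : ℝ) ≠ 0 := by exact_mod_cast hm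
  ext k
  fin_cases k
  · simp [ptF, onLine, apex]
    field_simp
    ring
  · simp only [ptF, onLine, apex]
    simp
    rw [show 2 * √3 * (m : ℝ) = 2 * m * √3 by ring, div_mul_sqrt_three]
    field_simp
    ring

lemma ptG_eq (hm : m ≠ 0) (j : ℕ) : ptG n m j = onLine n 2 3 (j / m) := by
  have hm' : (m : ℝ) ≠ 0 := by exact_mod_cast hm
  ext k
  fin_cases k
  · simp [ptG, onLine, apex]
  · simp only [ptG, onLine, apex]
    simp
    rw [mul_comm √3 (m : ℝ), div_mul_sqrt_three]
    field_simp
    ring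

lemma mem_tetrahedron (hn : n ≠ 0) (hm : m ≠ 0) {v : Plane} :
    v ∈ tetrahedron n m ↔
      ∃ a b, a ≠ b ∧ ∃ j, j ≤ sideParts n m a b ∧ v = onLine n a b (j / sideParts n m a b) := by
  have hrev : ∀ a b, sideParts n m a b ≠ 0 →
      (∃ j, j ≤ sideParts n m a b ∧ v = onLine n a b (j / sideParts n m a b)) →
      ∃ j, j ≤ sideParts n m b a ∧ v = onLine n b a (j / sideParts n m b a) := by
    rintro a b h0 ⟨j, hj, rfl⟩
    refine ⟨sideParts n m a b - j, sideParts_symm (n := n) (m := m) a b ▸ Nat.sub_le _ _, ?_⟩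
    have h0' : (sideParts n m a b : ℝ) ≠ 0 := by exact_mod_cast h0
    rw [onLine_symm, sideParts_symm b a, Nat.cast_sub hj, sub_div, div_self h0']
  have hmem : v ∈ tetrahedron n m ↔ ∃ p ∈ [((1 : Fin 4), (2 : Fin 4)), (2, 0), (0, 1), (0, 3),
      (1, 3), (2, 3)], ∃ j, j ≤ sideParts n m p.1 p.2 ∧
        v = onLine n p.1 p.2 (j / sideParts n m p.1 p.2) := by
    simp [tetrahedron, sideParts, ptA_eq hn, ptB_eq hn, ptC_eq hn, ptE_eq hm,
      ptF_eq hm, ptG_eq hm, eq_comm (b := v)]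
  rw [hmem]
  constructor
  · rintro ⟨p, hp, j, hj, h⟩
    refine ⟨p.1, p.2, ?_, j, hj, h⟩
    have : ∀ p ∈ [((1 : Fin 4), (2 : Fin 4)), (2, 0), (0, 1), (0, 3), (1, 3), (2, 3)],
      p.1 ≠ p.2 := by decide
    exact this p hp
  · rintro ⟨a, b, hab, h⟩
    have h0 : sideParts n m a b ≠ 0 := by
      unfold sideParts
      split_ifs <;> assumption
    have : ∀ a b : Fin 4, a ≠ b → (a, b) ∈ [((1 : Fin 4), (2 : Fin 4)), (2, 0), (0, 1), (0, 3),
      (1, 3), (2, 3)] ∨ (b, a) ∈ [((1 : Fin 4), (2 : Fin 4)), (2, 0), (0, 1), (0, 3),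
      (1, 3), (2, 3)] := by decide
    rcases this a b hab with h' | h'
    · exact ⟨_, h', h⟩
    · exact ⟨_, h', hrev a b h0 h⟩

end Tetrahedron

/-! ### The tetrahedron as a network, and the limit -/

section Instance

variable {n m : ℕ}

lemma onLine_zero (a b : Fin 4) : onLine n a b 0 = apex n a := by
  simp [onLine]

lemma onLine_mem_tetrahedron (hn : n ≠ 0) (hm : m ≠ 0) {a b : Fin 4} {j : ℕ}
    (hj : j ≤ sideParts n m a b) :
    onLine n a b (j / sideParts n m a b) ∈ tetrahedron n m := by
  by_cases hab : a = b
  · obtain ⟨c, hc⟩ : ∃ c, a ≠ c := exists_ne a |>.imp fun _ h => h.symm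
    refine (mem_tetrahedron hn hm).2 ⟨a, c, hc, 0, Nat.zero_le _, ?_⟩
    subst hab
    simp [onLine]
  · exact (mem_tetrahedron hn hm).2 ⟨a, b, hab, j, hj, rfl⟩

lemma two_le_sideParts (hn : 2 ≤ n) (hm : 2 ≤ m) (a b : Fin 4) : 2 ≤ sideParts n m a b := by
  unfold sideParts
  split_ifs <;> assumption

lemma sideLength_pos (hn : 2 ≤ n) (a b : Fin 4) : 0 < sideLength n a b := by
  have : (0 : ℝ) < n := by exact_mod_cast (by omega : 0 < n)
  unfold sideLength
  split_ifs <;> positivity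

lemma sideLength_le_sideParts (hnm : (n : ℝ) ≤ 3 / 2 * m) (a b : Fin 4) :
    sideLength n a b ≤ sideParts n m a b := by
  have hlt : √3 ≤ 2 := by rw [Real.sqrt_le_left (by norm_num)]; norm_num
  have hn : (0 : ℝ) ≤ n := by positivity
  unfold sideLength sideParts
  split_ifs
  · nlinarith
  · exact le_rfl

/-- The radii of balls around the apexes that touch each other. -/
noncomputable def apexRadius (n : ℕ) (a : Fin 4) : ℝ :=
  if a = 3 then n * √3 / 3 - n / 2 else n / 2

lemma apexRadius_pos (hn : 2 ≤ n) (a : Fin 4) : 0 < apexRadius n a := by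
  have hn' : (0 : ℝ) < n := by exact_mod_cast (by omega : 0 < n)
  have hlt : 3 / 2 < √3 := by rw [Real.lt_sqrt (by norm_num)]; norm_num
  unfold apexRadius
  split_ifs
  · nlinarith
  · positivity

lemma apexRadius_add {a b : Fin 4} (hab : a ≠ b) :
    apexRadius n a + apexRadius n b = sideLength n a b := by
  unfold apexRadius sideLength
  by_cases ha : a = 3 <;> by_cases hb : b = 3
  · exact absurd (ha.trans hb.symm) hab
  all_goals simp [ha, hb]

lemma sum_apexRadius : ∑ a, apexRadius n a = n * (1 + √3 / 3) := by
  rw [Fin.sum_univ_four]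
  simp only [apexRadius]
  norm_num [Fin.ext_iff]
  ring

/-- The tetrahedron instance as a network. -/
noncomputable def tetrahedronNetwork (hn : 2 ≤ n) (hm : 2 ≤ m) (hnm : (n : ℝ) ≤ 3 / 2 * m) :
    Network (tetrahedron n m) :=
  have hn0 : n ≠ 0 := by omega
  have hm0 : m ≠ 0 := by omega
  have hK0 : ∀ a b, (0 : ℝ) < sideParts n m a b := fun a b => by
    have := two_le_sideParts hn hm a b
    exact_mod_cast (by omega : 0 < sideParts n m a b)
  { corner := fun a => ⟨apex n a, by
      have := onLine_mem_tetrahedron hn0 hm0 (Nat.zero_le (sideParts n m a 0))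
      rwa [Nat.cast_zero, zero_div, onLine_zero] at this⟩
    -- The index is capped because every value of `pt` must be a vertex of the instance.
    pt := fun a b j => ⟨onLine n a b ((min j (sideParts n m a b) : ℕ) / sideParts n m a b),
      onLine_mem_tetrahedron hn0 hm0 (min_le_right _ _)⟩
    K := sideParts n m
    h := fun a b => sideLength n a b / sideParts n m a b
    r := apexRadius n
    K_symm := sideParts_symm
    two_le_K := two_le_sideParts hn hm
    h_pos := fun a b => div_pos (sideLength_pos hn a b) (hK0 a b)
    h_le_one := fun a b => (div_le_one (hK0 a b)).2 (sideLength_le_sideParts hnm a b)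
    r_pos := apexRadius_pos hn
    r_add := fun a b hab => by
      rw [apexRadius_add hab, mul_div_cancel₀ _ (hK0 a b).ne']
    pt_zero := fun a b => by
      refine Subtype.ext ?_
      simp only [Nat.zero_min, Nat.cast_zero, zero_div, onLine_zero]
    pt_rev := fun a b j hj => by
      refine Subtype.ext ?_
      simp only
      rw [min_eq_left (Nat.sub_le _ _), sideParts_symm b a, min_eq_left hj, Nat.cast_sub hj,
        sub_div, div_self (hK0 a b).ne', onLine_symm]
    dist_pt := fun a b hab i j hi hj => by
      rw [Subtype.dist_eq]
      simp only
      rw [min_eq_left hi, min_eq_left hj, dist_onLine n hab, ← sub_div, abs_div,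
        abs_of_pos (hK0 a b)]
      ring
    sep := fun a b c d hab hcd hne i j hi hj R h1 h2 => by
      rw [Subtype.dist_eq]
      simp only
      rw [min_eq_left hi, min_eq_left hj]
      have hi' : (i : ℝ) ≤ sideParts n m a b := by exact_mod_cast hi
      have hj' : (j : ℝ) ≤ sideParts n m c d := by exact_mod_cast hj
      refine div_four_le_dist_onLine n hab hcd hne (by positivity)
        ((div_le_one (hK0 a b)).2 hi') (by positivity) ((div_le_one (hK0 c d)).2 hj')
        (h1.trans (le_of_eq ?_)) (h2.trans (le_of_eq ?_))
      · ring
      · have := (hK0 a b).ne'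
        field_simp
    cover := fun v => by
      obtain ⟨a, b, hab, j, hj, h⟩ := (mem_tetrahedron hn0 hm0).1 v.2
      refine ⟨a, b, hab, j, hj, Subtype.ext ?_⟩
      simp only
      rw [min_eq_left hj, h] }

lemma tetrahedronNetwork_sum_r (hn : 2 ≤ n) (hm : 2 ≤ m) (hnm : (n : ℝ) ≤ 3 / 2 * m) :
    ∑ a, (tetrahedronNetwork hn hm hnm).r a = n * (1 + √3 / 3) := sum_apexRadius

/-- For the lower bound `O` may fall short of `4 * x` by less than `3 * x * ε`. The choice `R = 512
/ ε` makes the loss proportional to `O` at most half of this, and the first bound on `x` lets the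
other half absorb the constant loss. The second bound on `x` absorbs the 60. -/
lemma abs_div_sub_lt {ε x O L : ℝ} (hε : 0 < ε) (hε1 : ε ≤ 1) (hL : 3 * x - 60 ≤ L)
    (hL' : L ≤ 3 * x) (hO : O ≤ 4 * x)
    (hO' : 4 * x ≤ O + 48 * (2 * (512 / ε + 1) + 1 + 4 * O / (512 / ε)))
    (hx : 32 * (2 * (512 / ε) + 3) / ε < x) (hx' : 20 + 80 / ε < x) : |O / L - 4 / 3| < ε := by
  have h80 : 0 < 80 / ε := by positivity
  have hLpos : 0 < L := by linarith
  have h1 : 32 * (2 * (512 / ε) + 3) < x * ε := (div_lt_iff₀ hε).1 hx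
  have h2 : 80 < (x - 20) * ε := (div_lt_iff₀ hε).1 (by linarith)
  have h3 : 4 * O / (512 / ε) = O * ε / 128 := by
    field_simp
    ring
  rw [h3] at hO'
  have h4 : O * ε ≤ 4 * x * ε := mul_le_mul_of_nonneg_right hO hε.le
  rw [abs_lt]
  constructor
  · have : 4 / 3 - ε < O / L := by
      rw [lt_div_iff₀ hLpos]
      have : (4 / 3 - ε) * L ≤ (4 / 3 - ε) * (3 * x) :=
        mul_le_mul_of_nonneg_left hL' (by linarith)
      linarith
    linarith
  · have : O / L < 4 / 3 + ε := by
      rw [div_lt_iff₀ hLpos]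
      have : (4 / 3 + ε) * (3 * x - 60) ≤ (4 / 3 + ε) * L :=
        mul_le_mul_of_nonneg_left hL (by linarith)
      nlinarith
    linarith

/-- The integrality ratio of the tetrahedron instances tends to `4 / 3`. -/
lemma exists_forall_abs_integralityRatio_sub_lt (ε : ℝ) (hε : 0 < ε) :
    ∃ N : ℕ, ∀ n m : ℕ, N ≤ n → (n : ℝ) ≤ 3 / 2 * m →
      3 ≤ (tetrahedron n m).card ∧ |integralityRatio (tetrahedron n m) - 4 / 3| < ε := by
  set δ := min ε 1
  have hδ : 0 < δ := lt_min hε one_pos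
  obtain ⟨N, hN⟩ := exists_nat_gt (max (32 * (2 * (512 / δ) + 3) / δ) (20 + 80 / δ))
  -- From `3 ≤ n` it follows that `2 ≤ m`, so every segment has an inner vertex.
  refine ⟨max N 3, fun n m hn hnm => ?_⟩
  have hn3 : 3 ≤ n := (le_max_right _ _).trans hn
  have hNn : (N : ℝ) ≤ n := by exact_mod_cast (le_max_left _ _).trans hn
  have hm : 2 ≤ m := by
    have : (3 : ℝ) ≤ n := by exact_mod_cast hn3
    have : (2 : ℝ) ≤ m := by linarith
    exact_mod_cast this
  let T := tetrahedronNetwork (by omega : 2 ≤ n) hm hnm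
  have hS : ∑ a, T.r a = n * (1 + √3 / 3) := tetrahedronNetwork_sum_r _ _ _
  refine ⟨by simpa using T.three_le_card, lt_of_lt_of_le ?_ (min_le_left ε 1)⟩
  have hge : (n : ℝ) ≤ n * (1 + √3 / 3) :=
    le_mul_of_one_le_right (by positivity) (by linarith [Real.sqrt_nonneg 3])
  have h1 := T.le_optTourLength (R := 512 / δ) (by positivity)
  have h2 := T.optTourLength_le_four_mul
  have h3 := T.subtourLPValue_le_three_mul
  have h4 := T.three_mul_sub_le_subtourLPValue
  rw [hS] at h1 h2 h3 h4
  refine abs_div_sub_lt hδ (min_le_right _ _) h4 h3 h2 h1 ?_ ?_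
  · exact (le_max_left _ _).trans_lt (hN.trans_le (hNn.trans hge))
  · exact (le_max_right _ _).trans_lt (hN.trans_le (hNn.trans hge))

end Instance

end TSP

theorem mainTheorem1 :
    (∀ ε : ℝ, 0 < ε → ∃ N : ℕ, ∀ n m : ℕ, N ≤ n → 1 ≤ n → 1 ≤ m → (n : ℝ) ≤ 3 / 2 * (m : ℝ) →
      |TSP.integralityRatio (TSP.tetrahedron n m) - 4 / 3| < ε) ∧
    ((4 / 3 : ℝ) : EReal) ≤ TSP.euclideanIntegralityRatio := by
  constructor
  · intro ε hε
    obtain ⟨N, hN⟩ := TSP.exists_forall_abs_integralityRatio_sub_lt ε hε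
    exact ⟨N, fun n m hn _ _ hnm => (hN n m hn hnm).2⟩
  -- The instances with `m = n` already have ratios above every `q < 4 / 3`.
  · refine le_of_forall_lt fun c hc => ?_
    obtain ⟨q, hcq, hq⟩ := EReal.lt_iff_exists_real_btwn.1 hc
    have hq' : q < 4 / 3 := EReal.coe_lt_coe_iff.1 hq
    obtain ⟨N, hN⟩ := TSP.exists_forall_abs_integralityRatio_sub_lt (4 / 3 - q) (by linarith)
    have hNN : (N : ℝ) ≤ 3 / 2 * N := by
      have : (0 : ℝ) ≤ N := by positivity
      linarith
    obtain ⟨hcard, habs⟩ := hN N N le_rfl hNN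
    have hlt : q < TSP.integralityRatio (TSP.tetrahedron N N) := by
      linarith [(abs_lt.1 habs).1]
    refine hcq.trans ((EReal.coe_lt_coe_iff.2 hlt).trans_le ?_)
    exact le_iSup₂_of_le (TSP.tetrahedron N N) hcard le_rfl
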